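/- Let $-A$ be the generator of a $C_0$-semigroup $(T(t))_{t\ge 0}$ of bounded linear operators on a complex Banach space $X$, suppose that $\mathbb{C}_-:=\{\lambda\in\mathbb{C}:\operatorname{Re}\lambda<0\}\subseteq\rho(A)$, and let $\alpha,\gamma\in[0,\infty)$. Let $\omega\in\mathbb{R}$ be larger than the growth bound $\omega_0(T)$, and let $X_\gamma:=D((\omega+A)^\gamma)$ be the fractional domain with the graph norm $\|x\|_X+\|(\omega+A)^\gamma x\|_X$, where $(\omega+A)^{\gamma}$ is the inverse of $(\omega+A)^{-\gamma}x=\frac{1}{\Gamma(\gamma)}\int_0^\infty t^{\gamma-1}e^{-\omega t}T(t)x\,dt$ if $\gamma>0$, and the identity if $\gamma=0$. Then the following conditions are equivalent: 1. there exists $C\ge0$ such that $\|T(t)\|_{L(X_\gamma,X)}\le C(t^\alpha+1)$ for all $t\ge0$; 2. there exist $p,q\in[1,\infty]$ and $C'\ge0$ such that, for all $a\in(0,\infty)$, one has $(a+i\cdot+A)^{-1}\in\mathcal{M}_{p,q}(\mathbb{R};L(X_\gamma,X))$ and $$\|(a+i\cdot+A)^{-1}\|_{\mathcal{M}_{p,q}(\mathbb{R};L(X_\gamma,X))}\le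 C'(a^{-\alpha}+1).$$ Here, for Banach spaces $Y$ and $X$, consider functions $m:\mathbb{R}\to L(Y,X)$ such that $m(\cdot)y$ is strongly measurable for each $y\in Y$ and such that there are $\kappa>0$ and $g\in L^1(\mathbb{R})$ with $(1+|\xi|)^{-\kappa}\|m(\xi)\|\le g(\xi)$ for all $\xi\in\mathbb{R}$. For $p\in[1,\infty)$ and $q\in[1,\infty]$, $\mathcal{M}_{p,q}(\mathbb{R};L(Y,X))$ is the set of those $m$ for which the Fourier multiplier operator $T_mf=\mathcal{F}^{-1}(m\,\mathcal{F}f)$, with $f$ a $Y$-valued Schwartz function and $\mathcal{F}f(\xi)=\int_{\mathbb{R}}e^{-i\xi t}f(t)\,dt$, satisfies $\|T_mf\|_{L^q(\mathbb{R};X)}\le c\|f\|_{L^p(\mathbb{R};Y)}$ for some constant $c\geq0$ and all $f$; the norm of $m$ is the least such $c$. Moreover, $\mathcal{M}_{\infty,\infty}(\mathbb{R};L(Y,X))$ is the set of those $m$ for which there is $K:\mathbb{R}\to L(Y,X)$ such that, for all $y\in Y$, $K(\cdot)y$ is strongly measurable and integrable with $\mathcal{F}(K(\cdot)y)=m(\cdot)y$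 on $\mathbb{R}$, and for which $T_mf(t)=\int_{\mathbb{R}}K(t-s)f(s)\,ds$ satisfies $\|T_mf\|_{L^\infty(\mathbb{R};X)}\le c\|f\|_{L^\infty(\mathbb{R};Y)}$ for some constant $c\geq0$ and all $Y$-valued simple functions $f$; again the norm is the least such $c$. For $p=\infty\neq q$ the class $\mathcal{M}_{p,q}$ is not defined, and condition 2 does not refer to it. -/

import Mathlib

open MeasureTheory Set Filter Topology
open scoped ENNReal SchwartzMap

/-! ## Unbounded operators: resolvents -/

namespace LinearPMap

variable {X : Type*} [NormedAddCommGroup X] [NormedSpace ℂ X]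

/-- The bounded operator `R` is the (two-sided) inverse of `z - A : D(A) → X`. -/
def IsResolventAt (A : X →ₗ.[ℂ] X) (z : ℂ) (R : X →L[ℂ] X) : Prop :=
  (∀ x : X, ∃ h : R x ∈ A.domain, z • R x - A ⟨R x, h⟩ = x) ∧
    ∀ x : A.domain, R (z • (x : X) - A x) = x

/-- The resolvent set `ρ(A)` of a possibly unbounded operator `A`. -/
def resolventSet (A : X →ₗ.[ℂ] X) : Set ℂ :=
  {z | ∃ R : X →L[ℂ] X, A.IsResolventAt z R}

open Classical in
/-- The resolvent `(z - A)⁻¹` for `z ∈ ρ(A)`; by convention `0` for other `z`. -/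
noncomputable def resolvent (A : X →ₗ.[ℂ] X) (z : ℂ) : X →L[ℂ] X :=
  if h : ∃ R : X →L[ℂ] X, A.IsResolventAt z R then h.choose else 0

end LinearPMap

/-! ## Strongly continuous semigroups -/

/-- A `C₀`-semigroup `(T(t))_{t ≥ 0}` of bounded operators on `X`.  The values of `toFun` at
negative times are irrelevant. -/
structure C0Semigroup (X : Type*) [NormedAddCommGroup X] [NormedSpace ℂ X] where
  toFun : ℝ → X →L[ℂ] X
  map_zero : toFun 0 = ContinuousLinearMap.id ℂ X
  map_add : ∀ s t : ℝ, 0 ≤ s → 0 ≤ t → toFun (s + t) = toFun s ∘L toFun t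
  continuousOn_orbit : ∀ x : X, ContinuousOn (fun t => toFun t x) (Ici 0)

namespace C0Semigroup

variable {X : Type*} [NormedAddCommGroup X] [NormedSpace ℂ X]

instance : CoeFun (C0Semigroup X) (fun _ => ℝ → X →L[ℂ] X) := ⟨C0Semigroup.toFun⟩

/-- `B` is the generator of `T`: one has `x ∈ D(B)` and `B x = y` if and only if
`(T(h) x - x) / h → y` as `h ↓ 0`. -/
def IsGenerator (T : C0Semigroup X) (B : X →ₗ.[ℂ] X) : Prop :=
  ∀ x y : X, (x, y) ∈ B.graph ↔
    Tendsto (fun h : ℝ => (h : ℂ)⁻¹ • (T h x - x)) (𝓝[>] 0) (𝓝 y)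

/-- The growth bound `ω₀(T)`, the infimum (in the extended reals) of all `w ∈ ℝ` for which there
is `M ≥ 0` with `‖T(t)‖ ≤ M e^{wt}` for all `t ≥ 0`. -/
noncomputable def growthBound (T : C0Semigroup X) : EReal :=
  sInf ((fun w : ℝ => (w : EReal)) ''
    {w : ℝ | ∃ M : ℝ, 0 ≤ M ∧ ∀ t : ℝ, 0 ≤ t → ‖T t‖ ≤ M * Real.exp (w * t)})

theorem exists_bound (T : C0Semigroup X) {ω : ℝ} (hω : T.growthBound < (ω : EReal)) :
    ∃ w : ℝ, w < ω ∧ ∃ M : ℝ, 0 ≤ M ∧ ∀ t : ℝ, 0 ≤ t → ‖T t‖ ≤ M * Real.exp (w * t) := by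
  obtain ⟨_, ⟨w, hw, rfl⟩, hlt⟩ := sInf_lt_iff.1 hω
  exact ⟨w, EReal.coe_lt_coe_iff.1 hlt, hw⟩

/-! ### Negative fractional powers -/

/-- The integrand of the integral that defines `(ω + A)^{-γ} x`. -/
noncomputable def fracIntegrand (T : C0Semigroup X) (ω γ : ℝ) (x : X) (t : ℝ) : X :=
  ((t ^ (γ - 1) * Real.exp (-(ω * t)) : ℝ) : ℂ) • T t x

theorem norm_fracIntegrand_le (T : C0Semigroup X) {ω γ w M : ℝ}
    (hM : ∀ t : ℝ, 0 ≤ t → ‖T t‖ ≤ M * Real.exp (w * t)) (x : X) {t : ℝ} (ht : t ∈ Ioi (0 : ℝ)) :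
    ‖T.fracIntegrand ω γ x t‖ ≤
      (t ^ (γ - 1) * Real.exp (-(ω - w) * t ^ (1 : ℝ))) * (M * ‖x‖) := by
  have ht' : (0 : ℝ) < t := ht
  have h1 : 0 ≤ t ^ (γ - 1) := Real.rpow_nonneg ht'.le _
  have h2 : ‖T t x‖ ≤ M * Real.exp (w * t) * ‖x‖ :=
    ((T t).le_opNorm x).trans (mul_le_mul_of_nonneg_right (hM t ht'.le) (norm_nonneg _))
  rw [fracIntegrand, norm_smul, Complex.norm_real, Real.norm_of_nonneg (by positivity)]
  calc t ^ (γ - 1) * Real.exp (-(ω * t)) * ‖T t x‖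
      ≤ t ^ (γ - 1) * Real.exp (-(ω * t)) * (M * Real.exp (w * t) * ‖x‖) := by gcongr
    _ = _ := by
        rw [Real.rpow_one, show -(ω - w) * t = -(ω * t) + w * t by ring, Real.exp_add]
        ring

theorem integrableOn_majorant {ω γ w : ℝ} (hw : w < ω) (hγ : 0 < γ) :
    IntegrableOn (fun t : ℝ => t ^ (γ - 1) * Real.exp (-(ω - w) * t ^ (1 : ℝ))) (Ioi 0) :=
  integrableOn_rpow_mul_exp_neg_mul_rpow (by linarith) one_pos (by linarith)

theorem aestronglyMeasurable_fracIntegrand (T : C0Semigroup X) (ω γ : ℝ) (x : X) :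
    AEStronglyMeasurable (T.fracIntegrand ω γ x) (volume.restrict (Ioi 0)) := by
  have h1 : AEStronglyMeasurable (fun t => T t x) (volume.restrict (Ioi 0)) :=
    ((T.continuousOn_orbit x).mono Ioi_subset_Ici_self).aestronglyMeasurable measurableSet_Ioi
  have h2 : Measurable fun t : ℝ => ((t ^ (γ - 1) * Real.exp (-(ω * t)) : ℝ) : ℂ) := by fun_prop
  exact h2.aestronglyMeasurable.smul h1

theorem integrableOn_fracIntegrand (T : C0Semigroup X) {ω γ : ℝ}
    (hω : T.growthBound < (ω : EReal)) (hγ : 0 < γ) (x : X) :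
    IntegrableOn (T.fracIntegrand ω γ x) (Ioi 0) := by
  obtain ⟨w, hw, M, hM0, hM⟩ := T.exists_bound hω
  refine Integrable.mono' ((integrableOn_majorant hw hγ).mul_const (M * ‖x‖))
    (T.aestronglyMeasurable_fracIntegrand ω γ x) ?_
  filter_upwards [ae_restrict_mem measurableSet_Ioi] with t ht
  exact T.norm_fracIntegrand_le hM x ht

open Classical in
/-- The negative fractional power `(ω + A)^{-γ}`, where `-A` is the generator of `T` and
`ω > ω₀(T)`: the identity for `γ = 0` (and, as a convention that is never used, for `γ < 0`), and
`(ω + A)^{-γ} x = Γ(γ)⁻¹ ∫₀^∞ t^{γ-1} e^{-ωt} T(t) x dt` for `γ > 0`. -/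
noncomputable def negFracPow (T : C0Semigroup X) (ω γ : ℝ) (hω : T.growthBound < (ω : EReal)) :
    X →L[ℂ] X :=
  if hγ : 0 < γ then
    LinearMap.mkContinuousOfExistsBound
      { toFun := fun x => ((Real.Gamma γ)⁻¹ : ℂ) • ∫ t in Ioi (0 : ℝ), T.fracIntegrand ω γ x t
        map_add' := fun x y => by
          rw [← smul_add, ← integral_add (T.integrableOn_fracIntegrand hω hγ x)
            (T.integrableOn_fracIntegrand hω hγ y)]
          simp only [fracIntegrand, _root_.map_add, smul_add]
        map_smul' := fun c x => by
          rw [RingHom.id_apply, smul_comm c, ← integral_smul c]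
          simp only [fracIntegrand, map_smul, smul_comm c] }
      (by
        obtain ⟨w, hw, M, hM0, hM⟩ := T.exists_bound hω
        refine ⟨‖((Real.Gamma γ)⁻¹ : ℂ)‖ * ((∫ t in Ioi (0 : ℝ),
          t ^ (γ - 1) * Real.exp (-(ω - w) * t ^ (1 : ℝ))) * M), fun x => ?_⟩
        change ‖((Real.Gamma γ)⁻¹ : ℂ) • ∫ t in Ioi (0 : ℝ), T.fracIntegrand ω γ x t‖ ≤ _
        rw [norm_smul, mul_assoc, mul_assoc, ← integral_mul_const]
        refine mul_le_mul_of_nonneg_left (norm_integral_le_of_norm_le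
          ((integrableOn_majorant hw hγ).mul_const (M * ‖x‖)) ?_) (norm_nonneg _)
        filter_upwards [ae_restrict_mem measurableSet_Ioi] with t ht
        exact T.norm_fracIntegrand_le hM x ht)
  else ContinuousLinearMap.id ℂ X

theorem negFracPow_apply (T : C0Semigroup X) {ω γ : ℝ} (hω : T.growthBound < (ω : EReal))
    (hγ : 0 < γ) (x : X) : T.negFracPow ω γ hω x =
      ((Real.Gamma γ)⁻¹ : ℂ) • ∫ t in Ioi (0 : ℝ), T.fracIntegrand ω γ x t := by
  rw [negFracPow, dif_pos hγ]
  rfl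

theorem negFracPow_of_nonpos (T : C0Semigroup X) {ω γ : ℝ} (hω : T.growthBound < (ω : EReal))
    (hγ : γ ≤ 0) : T.negFracPow ω γ hω = ContinuousLinearMap.id ℂ X :=
  dif_neg hγ.not_gt

/-- Auxiliary: the power `t ^ (γ - 1)`, extended by zero to the negative half-line. -/
noncomputable def powKernel (γ : ℝ) : ℝ → ℂ :=
  (Ioi 0).indicator fun t => ((t ^ (γ - 1) : ℝ) : ℂ)

/-- Auxiliary: the rescaled orbit `e^{-ωt} T(t) x`, extended by zero to the negative half-line. -/
noncomputable def scaledOrbit (T : C0Semigroup X) (ω : ℝ) (x : X) : ℝ → X :=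
  (Ioi 0).indicator fun t => ((Real.exp (-(ω * t)) : ℝ) : ℂ) • T t x

theorem integral_powKernel_mul {γ δ : ℝ} (hγ : 0 < γ) (hδ : 0 < δ) {v : ℝ} (hv : 0 < v) :
    ∫ s : ℝ, powKernel δ s * powKernel γ (v - s) =
      (Real.Gamma δ : ℂ) * Real.Gamma γ * (Real.Gamma (γ + δ) : ℂ)⁻¹ *
        ((v ^ (γ + δ - 1) : ℝ) : ℂ) := by
  have h1 : ∀ s : ℝ, powKernel δ s * powKernel γ (v - s) =
      (Ioo 0 v).indicator (fun s : ℝ => (s : ℂ) ^ ((δ : ℂ) - 1) *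
        ((v : ℂ) - s) ^ ((γ : ℂ) - 1)) s := by
    intro s
    by_cases hs : s ∈ Ioo 0 v
    · have h2 : (0 : ℝ) < v - s := sub_pos.2 hs.2
      rw [indicator_of_mem hs, powKernel, powKernel, indicator_of_mem (show s ∈ Ioi 0 from hs.1),
        indicator_of_mem (show v - s ∈ Ioi 0 from h2), Complex.ofReal_cpow hs.1.le,
        Complex.ofReal_cpow h2.le]
      push_cast
      rfl
    · rw [indicator_of_notMem hs, powKernel, powKernel]
      by_cases hs0 : 0 < s
      · rw [indicator_of_notMem (s := Ioi (0 : ℝ)) (a := v - s), mul_zero]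
        intro h
        exact hs ⟨hs0, sub_pos.1 h⟩
      · rw [indicator_of_notMem (s := Ioi (0 : ℝ)) (a := s) hs0, zero_mul]
  have hne : (Real.Gamma (γ + δ) : ℂ) ≠ 0 :=
    Complex.ofReal_ne_zero.2 (Real.Gamma_pos_of_pos (add_pos hγ hδ)).ne'
  simp_rw [h1]
  rw [integral_indicator measurableSet_Ioo, ← integral_Ioc_eq_integral_Ioo,
    ← intervalIntegral.integral_of_le hv.le, Complex.betaIntegral_scaled _ _ hv]
  have h3 := Complex.Gamma_mul_Gamma_eq_betaIntegral (s := (δ : ℂ)) (t := (γ : ℂ))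
    (by simpa using hδ) (by simpa using hγ)
  rw [Complex.Gamma_ofReal, Complex.Gamma_ofReal, ← Complex.ofReal_add, Complex.Gamma_ofReal,
    add_comm δ γ] at h3
  rw [h3, Complex.ofReal_cpow hv.le]
  push_cast
  rw [add_comm (δ : ℂ) γ]
  field_simp

/-- The law of exponents for negative powers. -/
theorem negFracPow_negFracPow [CompleteSpace X] (T : C0Semigroup X) {ω γ δ : ℝ}
    (hω : T.growthBound < (ω : EReal)) (hγ : 0 < γ) (hδ : 0 < δ) (x : X) :
    T.negFracPow ω δ hω (T.negFracPow ω γ hω x) = T.negFracPow ω (γ + δ) hω x := by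
  set u := T.scaledOrbit ω x with hu
  have hγδ : 0 < γ + δ := add_pos hγ hδ
  -- measurability of the orbit
  have hum : AEStronglyMeasurable u volume := by
    rw [hu, scaledOrbit, aestronglyMeasurable_indicator_iff measurableSet_Ioi]
    have h1 : AEStronglyMeasurable (fun t => T t x) (volume.restrict (Ioi 0)) :=
      ((T.continuousOn_orbit x).mono Ioi_subset_Ici_self).aestronglyMeasurable measurableSet_Ioi
    have h2 : Measurable fun t : ℝ => ((Real.exp (-(ω * t)) : ℝ) : ℂ) := by fun_prop
    exact h2.aestronglyMeasurable.smul h1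
  have hkm : ∀ β : ℝ, Measurable (powKernel β) := fun β =>
    Measurable.indicator (by fun_prop) measurableSet_Ioi
  -- integrability of the double integral
  have hH : Integrable (fun z : ℝ × ℝ => (powKernel δ z.1 * powKernel γ z.2) • u (z.1 + z.2))
      (volume.prod volume) := by
    obtain ⟨w, hw, M, hM0, hM⟩ := T.exists_bound hω
    have hP : ∀ {β : ℝ}, 0 < β → Integrable ((Ioi (0 : ℝ)).indicator fun t : ℝ =>
        t ^ (β - 1) * Real.exp (-(ω - w) * t ^ (1 : ℝ))) := fun hβ =>
      (integrable_indicator_iff measurableSet_Ioi).2 (integrableOn_majorant hw hβ)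
    refine Integrable.mono' (((hP hδ).mul_prod (hP hγ)).mul_const (M * ‖x‖)) ?_ ?_
    · refine AEStronglyMeasurable.smul ?_ ?_
      · exact (((hkm δ).comp measurable_fst).mul
          ((hkm γ).comp measurable_snd)).aestronglyMeasurable
      · exact hum.comp_quasiMeasurePreserving (quasiMeasurePreserving_add volume volume)
    · refine Eventually.of_forall fun z => ?_
      obtain ⟨s, t⟩ := z
      by_cases hs : s ∈ Ioi (0 : ℝ)
      · by_cases ht : t ∈ Ioi (0 : ℝ)
        · have hs' : (0 : ℝ) < s := hs
          have ht' : (0 : ℝ) < t := ht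
          have hst : s + t ∈ Ioi (0 : ℝ) := add_pos hs' ht'
          have h2 : ‖T (s + t) x‖ ≤ M * Real.exp (w * (s + t)) * ‖x‖ :=
            ((T (s + t)).le_opNorm x).trans
              (mul_le_mul_of_nonneg_right (hM _ (add_pos hs' ht').le) (norm_nonneg _))
          have h3 : 0 ≤ s ^ (δ - 1) := Real.rpow_nonneg hs'.le _
          have h4 : 0 ≤ t ^ (γ - 1) := Real.rpow_nonneg ht'.le _
          simp only [hu, powKernel, scaledOrbit, indicator_of_mem hs, indicator_of_mem ht,
            indicator_of_mem hst, norm_smul, norm_mul, Complex.norm_real, Real.norm_eq_abs,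
            abs_of_nonneg h3, abs_of_nonneg h4, Real.abs_exp]
          calc s ^ (δ - 1) * t ^ (γ - 1) * (Real.exp (-(ω * (s + t))) * ‖T (s + t) x‖)
              ≤ s ^ (δ - 1) * t ^ (γ - 1) * (Real.exp (-(ω * (s + t))) *
                (M * Real.exp (w * (s + t)) * ‖x‖)) := by gcongr
            _ = _ := by
              have h5 : Real.exp (-(ω * (s + t))) * Real.exp (w * (s + t)) =
                  Real.exp (-(ω - w) * s) * Real.exp (-(ω - w) * t) := by
                rw [← Real.exp_add, ← Real.exp_add]; ring_nf
              rw [Real.rpow_one, Real.rpow_one]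
              linear_combination (s ^ (δ - 1) * t ^ (γ - 1) * M * ‖x‖) * h5
        · simp [powKernel, indicator_of_notMem ht]
      · simp [powKernel, indicator_of_notMem hs]
  have hG : Integrable (fun z : ℝ × ℝ => (powKernel δ z.1 * powKernel γ (z.2 - z.1)) • u z.2)
      (volume.prod volume) := by
    have h := (measurePreserving_prod_sub (volume : Measure ℝ)
      (volume : Measure ℝ)).integrable_comp_of_integrable hH
    refine h.congr (Eventually.of_forall fun z => ?_)
    simp
  -- the inner integral
  have hin : ∀ s ∈ Ioi (0 : ℝ), T.fracIntegrand ω δ (∫ t in Ioi (0 : ℝ), T.fracIntegrand ω γ x t) s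
      = ∫ v : ℝ, (powKernel δ s * powKernel γ (v - s)) • u v := by
    intro s hs
    have hs' : (0 : ℝ) < s := hs
    rw [← integral_add_right_eq_self (fun v : ℝ => (powKernel δ s * powKernel γ (v - s)) • u v) s,
      fracIntegrand,
      ← ContinuousLinearMap.integral_comp_comm _ (T.integrableOn_fracIntegrand hω hγ x),
      ← integral_smul, ← integral_indicator measurableSet_Ioi]
    congr 1
    ext t
    by_cases ht : t ∈ Ioi (0 : ℝ)
    · have ht' : (0 : ℝ) < t := ht
      have hst : t + s ∈ Ioi (0 : ℝ) := add_pos ht' hs'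
      rw [indicator_of_mem ht, fracIntegrand, map_smul, add_sub_cancel_right, powKernel, powKernel,
        indicator_of_mem hs, indicator_of_mem ht, hu, scaledOrbit, indicator_of_mem hst,
        add_comm t s, T.map_add s t hs'.le ht'.le, ContinuousLinearMap.comp_apply, smul_smul,
        smul_smul]
      congr 1
      rw [mul_add, neg_add, Real.exp_add]
      push_cast
      ring
    · rw [indicator_of_notMem ht, add_sub_cancel_right, powKernel, powKernel,
        indicator_of_notMem ht, mul_zero, zero_smul]
  have hmain : ∫ s in Ioi (0 : ℝ),
      T.fracIntegrand ω δ (∫ t in Ioi (0 : ℝ), T.fracIntegrand ω γ x t) s =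
      ((Real.Gamma δ : ℂ) * Real.Gamma γ * (Real.Gamma (γ + δ) : ℂ)⁻¹) •
        ∫ v in Ioi (0 : ℝ), T.fracIntegrand ω (γ + δ) x v := by
    rw [setIntegral_congr_fun measurableSet_Ioi hin]
    rw [setIntegral_eq_integral_of_forall_compl_eq_zero (fun s hs => by
      simp [powKernel, indicator_of_notMem hs])]
    rw [integral_integral_swap hG, ← integral_smul, ← integral_indicator measurableSet_Ioi]
    congr 1
    ext v
    rw [integral_smul_const]
    by_cases hv : v ∈ Ioi (0 : ℝ)
    · rw [indicator_of_mem hv, integral_powKernel_mul hγ hδ hv, hu, scaledOrbit,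
        indicator_of_mem hv, fracIntegrand, smul_smul, smul_smul]
      congr 1
      push_cast
      ring
    · rw [indicator_of_notMem hv, hu, scaledOrbit, indicator_of_notMem hv, smul_zero]
  have hδ' : (Real.Gamma δ : ℂ) ≠ 0 := Complex.ofReal_ne_zero.2 (Real.Gamma_pos_of_pos hδ).ne'
  have hγ' : (Real.Gamma γ : ℂ) ≠ 0 := Complex.ofReal_ne_zero.2 (Real.Gamma_pos_of_pos hγ).ne'
  rw [T.negFracPow_apply hω hγ x, map_smul, T.negFracPow_apply hω hδ, hmain,
    T.negFracPow_apply hω hγδ, smul_smul, smul_smul]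
  congr 1
  field_simp

/-- `(ω + A)⁻¹` is injective. -/
theorem negFracPow_one_eq_zero [CompleteSpace X] (T : C0Semigroup X) {ω : ℝ}
    (hω : T.growthBound < (ω : EReal)) {x : X} (hx : T.negFracPow ω 1 hω x = 0) : x = 0 := by
  have hint := T.integrableOn_fracIntegrand hω one_pos x
  have hf : ∀ t : ℝ, T.fracIntegrand ω 1 x t = ((Real.exp (-(ω * t)) : ℝ) : ℂ) • T t x := by
    intro t
    simp [fracIntegrand]
  have hcont : ContinuousOn (T.fracIntegrand ω 1 x) (Ici 0) := by
    refine ContinuousOn.congr ?_ fun t _ => hf t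
    exact ContinuousOn.smul (Continuous.continuousOn (by fun_prop)) (T.continuousOn_orbit x)
  have h0 : ∫ t in Ioi (0 : ℝ), T.fracIntegrand ω 1 x t = 0 := by
    rw [T.negFracPow_apply hω one_pos] at hx
    simpa using hx
  have htail : ∀ s : ℝ, 0 ≤ s → ∫ t in Ioi s, T.fracIntegrand ω 1 x t = 0 := by
    intro s hs
    have h1 : ((Real.exp (-(ω * s)) : ℝ) : ℂ) • T s (∫ t in Ioi (0 : ℝ), T.fracIntegrand ω 1 x t)
        = ∫ t in Ioi (0 : ℝ), T.fracIntegrand ω 1 x (t + s) := by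
      rw [← ContinuousLinearMap.integral_comp_comm _ hint, ← integral_smul]
      refine setIntegral_congr_fun measurableSet_Ioi fun t ht => ?_
      have ht' : (0 : ℝ) < t := ht
      simp only [hf]
      rw [map_smul, add_comm t s, T.map_add s t hs ht'.le, ContinuousLinearMap.comp_apply,
        smul_smul, mul_add, neg_add, Real.exp_add]
      push_cast
      rfl
    rw [h0, _root_.map_zero, smul_zero] at h1
    have h2 := (measurePreserving_add_right volume s).setIntegral_preimage_emb
      (measurableEmbedding_addRight s) (T.fracIntegrand ω 1 x) (Ioi s)
    rw [← h2, preimage_add_const_Ioi, sub_self, h1]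
  have hzero : ∀ s ∈ Ici (0 : ℝ), ∫ t in (0 : ℝ)..s, T.fracIntegrand ω 1 x t = 0 := by
    intro s hs
    have hs' : (0 : ℝ) ≤ s := hs
    rw [← intervalIntegral.integral_Ioi_sub_Ioi hint hs', h0, htail s hs', sub_zero]
  have hder : HasDerivWithinAt (fun s => ∫ t in (0 : ℝ)..s, T.fracIntegrand ω 1 x t)
      (T.fracIntegrand ω 1 x 0) (Ici 0) 0 := by
    refine intervalIntegral.integral_hasDerivWithinAt_right (by simp) ?_
      (hcont 0 self_mem_Ici |>.mono Ioi_subset_Ici_self)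
    exact (hcont.mono Ioi_subset_Ici_self).stronglyMeasurableAtFilter_nhdsWithin
      measurableSet_Ioi 0
  have hder' : HasDerivWithinAt (fun _ : ℝ => (0 : X)) (T.fracIntegrand ω 1 x 0) (Ici 0) 0 :=
    hder.congr (fun s hs => (hzero s hs).symm) (hzero 0 self_mem_Ici).symm
  have h2 := (uniqueDiffOn_Ici (0 : ℝ) 0 self_mem_Ici).eq_deriv _ hder'
    (hasDerivWithinAt_const (0 : ℝ) (Ici (0 : ℝ)) (0 : X))
  simpa [hf, T.map_zero] using h2

/-- `(ω + A)^{-γ}` is injective. -/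
theorem negFracPow_injective [CompleteSpace X] (T : C0Semigroup X) {ω : ℝ} (γ : ℝ)
    (hω : T.growthBound < (ω : EReal)) : Function.Injective (T.negFracPow ω γ hω) := by
  rcases le_or_gt γ 0 with hγ | hγ
  · rw [T.negFracPow_of_nonpos hω hγ]
    exact Function.injective_id
  have hnat : ∀ n : ℕ, ∀ x : X, T.negFracPow ω ((n : ℝ) + 1) hω x = 0 → x = 0 := by
    intro n
    induction n with
    | zero =>
      intro x hx
      rw [Nat.cast_zero, zero_add] at hx
      exact T.negFracPow_one_eq_zero hω hx
    | succ n ih =>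
      intro x hx
      rw [Nat.cast_succ, ← T.negFracPow_negFracPow hω (by positivity) one_pos] at hx
      exact ih x (T.negFracPow_one_eq_zero hω hx)
  rw [injective_iff_map_eq_zero]
  intro x hx
  have hδ : 0 < (⌊γ⌋₊ : ℝ) + 1 - γ := sub_pos.2 (Nat.lt_floor_add_one γ)
  refine hnat ⌊γ⌋₊ x ?_
  have h := T.negFracPow_negFracPow hω hγ hδ x
  rw [hx, _root_.map_zero, add_sub_cancel] at h
  exact h.symm

/-! ### Fractional domains -/

/-- The fractional domain `X_γ = D((ω + A)^γ)`, that is the range of `(ω + A)^{-γ}`, where `-A` is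
the generator of `T`.  It carries the graph norm of `(ω + A)^γ`, see below. -/
def FracDomain [CompleteSpace X] (T : C0Semigroup X) (ω γ : ℝ)
    (hω : T.growthBound < (ω : EReal)) : Type _ :=
  LinearMap.range (T.negFracPow ω γ hω).toLinearMap

namespace FracDomain

variable [CompleteSpace X] {T : C0Semigroup X} {ω γ : ℝ} {hω : T.growthBound < (ω : EReal)}

noncomputable instance : AddCommGroup (T.FracDomain ω γ hω) :=
  inferInstanceAs (AddCommGroup (LinearMap.range (T.negFracPow ω γ hω).toLinearMap))

noncomputable instance : Module ℂ (T.FracDomain ω γ hω) :=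
  inferInstanceAs (Module ℂ (LinearMap.range (T.negFracPow ω γ hω).toLinearMap))

/-- The inclusion of `X_γ` into `X`, as a linear map. -/
noncomputable def inclₗ : T.FracDomain ω γ hω →ₗ[ℂ] X :=
  (LinearMap.range (T.negFracPow ω γ hω).toLinearMap).subtype

/-- The fractional power `(ω + A)^γ : X_γ → X`, the inverse of `(ω + A)^{-γ} : X → X_γ`. -/
noncomputable def fracPow : T.FracDomain ω γ hω →ₗ[ℂ] X :=
  (LinearEquiv.ofInjective (T.negFracPow ω γ hω).toLinearMap
    (T.negFracPow_injective γ hω)).symm.toLinearMap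

theorem inclₗ_injective : Function.Injective (inclₗ : T.FracDomain ω γ hω →ₗ[ℂ] X) :=
  Subtype.val_injective

theorem negFracPow_fracPow (x : T.FracDomain ω γ hω) :
    T.negFracPow ω γ hω (fracPow x) = inclₗ x :=
  congrArg Subtype.val ((LinearEquiv.ofInjective (T.negFracPow ω γ hω).toLinearMap
    (T.negFracPow_injective γ hω)).apply_symm_apply x)

theorem exists_of_eq (x y : X) (h : T.negFracPow ω γ hω y = x) :
    ∃ z : T.FracDomain ω γ hω, inclₗ z = x ∧ fracPow z = y := by
  let z : T.FracDomain ω γ hω := ⟨x, LinearMap.mem_range.2 ⟨y, h⟩⟩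
  exact ⟨z, rfl, T.negFracPow_injective γ hω ((negFracPow_fracPow z).trans h.symm)⟩

/-- `X_γ` carries the graph norm `‖x‖_{X_γ} = ‖x‖ + ‖(ω + A)^γ x‖`. -/
noncomputable instance : NormedAddCommGroup (T.FracDomain ω γ hω) :=
  AddGroupNorm.toNormedAddCommGroup
    { toFun := fun x => ‖inclₗ x‖ + ‖fracPow x‖
      map_zero' := by simp
      add_le' := fun x y => by
        rw [_root_.map_add, _root_.map_add]
        linarith [norm_add_le (inclₗ x) (inclₗ y), norm_add_le (fracPow x) (fracPow y)]
      neg' := fun x => by simp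
      eq_zero_of_map_eq_zero' := fun x hx => by
        have h : ‖inclₗ x‖ = 0 := by
          linarith [norm_nonneg (inclₗ x), norm_nonneg (fracPow x)]
        exact inclₗ_injective (by rw [norm_eq_zero.1 h, _root_.map_zero]) }

theorem norm_eq (x : T.FracDomain ω γ hω) : ‖x‖ = ‖inclₗ x‖ + ‖fracPow x‖ := rfl

noncomputable instance : NormedSpace ℂ (T.FracDomain ω γ hω) where
  norm_smul_le c x := by
    rw [norm_eq, norm_eq, map_smul, map_smul, norm_smul, norm_smul, mul_add]

/-- The continuous inclusion of `X_γ` into `X`. -/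
noncomputable def incl (T : C0Semigroup X) (ω γ : ℝ) (hω : T.growthBound < (ω : EReal)) :
    T.FracDomain ω γ hω →L[ℂ] X :=
  inclₗ.mkContinuous 1 fun x => by
    rw [one_mul, norm_eq]
    linarith [norm_nonneg (fracPow x)]

/-- `X_γ` is a Banach space. -/
instance : CompleteSpace (T.FracDomain ω γ hω) := by
  refine Metric.complete_of_cauchySeq_tendsto fun u hu => ?_
  have hi : ∀ x y : T.FracDomain ω γ hω, dist (inclₗ x) (inclₗ y) ≤ dist x y := fun x y => by
    rw [dist_eq_norm, dist_eq_norm, norm_eq, map_sub]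
    linarith [norm_nonneg (fracPow (x - y))]
  have hj : ∀ x y : T.FracDomain ω γ hω, dist (fracPow x) (fracPow y) ≤ dist x y := fun x y => by
    rw [dist_eq_norm, dist_eq_norm, norm_eq, map_sub (fracPow (hω := hω))]
    linarith [norm_nonneg (inclₗ (x - y))]
  have hcau : ∀ f : T.FracDomain ω γ hω → X, (∀ x y, dist (f x) (f y) ≤ dist x y) →
      CauchySeq fun n => f (u n) := fun f hf => by
    rw [Metric.cauchySeq_iff] at hu ⊢
    intro ε hε
    obtain ⟨N, hN⟩ := hu ε hε
    exact ⟨N, fun m hm n hn => (hf _ _).trans_lt (hN m hm n hn)⟩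
  obtain ⟨x, hx⟩ := cauchySeq_tendsto_of_complete (hcau inclₗ hi)
  obtain ⟨y, hy⟩ := cauchySeq_tendsto_of_complete (hcau fracPow hj)
  have hxy : T.negFracPow ω γ hω y = x := by
    refine tendsto_nhds_unique (((T.negFracPow ω γ hω).continuous.tendsto y).comp hy) ?_
    refine hx.congr fun n => ?_
    rw [Function.comp_apply, negFracPow_fracPow]
  obtain ⟨z, hz1, hz2⟩ := exists_of_eq x y hxy
  refine ⟨z, ?_⟩
  rw [tendsto_iff_norm_sub_tendsto_zero] at hx hy ⊢
  have h := hx.add hy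
  rw [add_zero] at h
  refine h.congr fun n => ?_
  rw [norm_eq, map_sub, map_sub, hz1, hz2]

end FracDomain

end C0Semigroup

/-! ## Operator-valued Fourier multipliers on the real line -/

namespace FourierMult

variable {Y X : Type*} [NormedAddCommGroup Y] [NormedSpace ℂ Y]
  [NormedAddCommGroup X] [NormedSpace ℂ X]

/-- The Fourier transform `∫ e^{-iξt} f(t) dt`. -/
noncomputable def fourierHat (f : ℝ → Y) (ξ : ℝ) : Y :=
  ∫ t : ℝ, Complex.exp (-(Complex.I * ξ * t)) • f t

/-- `m` is `Y`-strongly measurable: `ξ ↦ m(ξ) y` is strongly measurable for every `y`. -/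
def IsStronglyMeas (m : ℝ → Y →L[ℂ] X) : Prop :=
  ∀ y : Y, StronglyMeasurable fun ξ => m ξ y

/-- `m` is of moderate growth. -/
def IsModerate (m : ℝ → Y →L[ℂ] X) : Prop :=
  ∃ κ : ℝ, 0 < κ ∧ ∃ g : ℝ → ℝ, Integrable g ∧ ∀ ξ : ℝ, (1 + |ξ|) ^ (-κ) * ‖m ξ‖ ≤ g ξ

/-- The Fourier multiplier operator `T_m f = F⁻¹(m · F f)` on a Schwartz function `f`.  If `m` is
strongly measurable and of moderate growth, then `m · F f` is integrable, so that its inverse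
Fourier transform is the continuous function `t ↦ (2π)⁻¹ ∫ e^{itξ} m(ξ) (F f)(ξ) dξ`. -/
noncomputable def multOp (m : ℝ → Y →L[ℂ] X) (f : 𝓢(ℝ, Y)) (t : ℝ) : X :=
  ((2 * Real.pi : ℝ) : ℂ)⁻¹ • ∫ ξ : ℝ, Complex.exp (Complex.I * ξ * t) • m ξ (fourierHat f ξ)

/-- `K` is a kernel of `m`: it is strongly measurable, `K(·) y` is integrable, and
`F(K(·) y)(ξ) = m(ξ) y`, for all `y` and `ξ`. -/
def IsKernel (K m : ℝ → Y →L[ℂ] X) : Prop :=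
  IsStronglyMeas K ∧ ∀ y : Y, Integrable (fun t => K t y) ∧
    ∀ ξ : ℝ, fourierHat (fun t => K t y) ξ = m ξ y

/-- The constant `C` bounds `T_m` from `L^p` to `L^q`.  For `p < ∞` this is tested on the (dense)
Schwartz functions.  For `p = q = ∞` it is tested on simple functions, on which `T_m` is
convolution with the kernel of `m`.  There is no notion for `p = ∞ ≠ q`. -/
def MultBound (p q : ℝ≥0∞) (m : ℝ → Y →L[ℂ] X) (C : ℝ) : Prop :=
  (p ≠ ∞ ∧ ∀ f : 𝓢(ℝ, Y),
      eLpNorm (multOp m f) q volume ≤ ENNReal.ofReal C * eLpNorm f p volume) ∨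
    (p = ∞ ∧ q = ∞ ∧ ∃ K : ℝ → Y →L[ℂ] X, IsKernel K m ∧ ∀ f : SimpleFunc ℝ Y,
      eLpNorm (fun t : ℝ => ∫ s : ℝ, K (t - s) (f s)) ∞ volume ≤
        ENNReal.ofReal C * eLpNorm f ∞ volume)

/-- The class `M_{p,q}(ℝ; L(Y, X))` of bounded `(L^p, L^q)` Fourier multipliers. -/
def Mult (p q : ℝ≥0∞) : Set (ℝ → Y →L[ℂ] X) :=
  {m | IsStronglyMeas m ∧ IsModerate m ∧ ∃ C : ℝ, 0 ≤ C ∧ MultBound p q m C}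

/-- The norm of `M_{p,q}(ℝ; L(Y, X))`: the operator norm of `T_m`, the least bound. -/
noncomputable def multNorm (p q : ℝ≥0∞) (m : ℝ → Y →L[ℂ] X) : ℝ :=
  sInf {C : ℝ | 0 ≤ C ∧ MultBound p q m C}

end FourierMult

/-! Write `J` for the inclusion of `X_γ` into `X`, and `R` for the resolvent of `-A`. Wherever the
Laplace integral converges absolutely, `ξ ↦ R(a + iξ) J` is the Fourier transform of the kernel
`e^{-as} T(s) J` on the positive half-line, so its multiplier operator is convolution with that
kernel.

If the semigroup grows at most like `t^α + 1` on `X_γ`, the kernel is bounded in norm by a multiple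
of `a^{-α} + 1`. Convolution with a bounded kernel maps `L^1` to `L^∞`, so `p = 1` and `q = ∞` will
do (`exists_mult_of_growth`).

Conversely, take `a = 1/t` and feed the multiplier the input `s ↦ e^{-as} φ(s) T(s) x`, where `φ` is
a smooth probability density on `[0, 1]`. Its `L^p` norm is bounded by a multiple of the norm of
`x`, whatever `p` is. For `τ > 1` the output at `τ` is `e^{-aτ} ∫ φ(s) T(τ - s) T(s) x ds = e^{-aτ}
T(τ) x`. On `(t - 1, t]` the factor `e^{-aτ}` is at least `1/e`, and `T(τ) x` controls `T(t) x`, so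
the `L^q` norm of the output dominates a multiple of `‖T(t) x‖` (`exists_growth_of_multBound`). The
orbit need not be smooth, so it is replaced by finite sums of elementary tensors built from
Bernstein polynomials.

The obstacle is that the Laplace integral need not converge for small `a > 0`, so the convolution
formula has to be carried over from large abscissae by shifting a vertical contour
(`multOp_resolvent_tensor`). No pointwise bound of the resolvent along horizontal segments is at
hand, only multiplier bounds. Averaging the horizontal integrals over a window around height `N`
turns them into values of the multiplier operators on modulated Schwartz functions, which are
bounded uniformly in `N`. An integration by parts in the test function then gains a factor `1/|N|`
(`avgIntegral_decay`), and such averages suffice for the contour shift (`integral_vertical_eq`). -/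

/-! ### Resolvents: local bounds, continuity and holomorphy. -/

namespace LinearPMap

variable {X : Type*} [NormedAddCommGroup X] [NormedSpace ℂ X]

theorem isResolventAt_resolvent {A : X →ₗ.[ℂ] X} {z : ℂ} (h : z ∈ A.resolventSet) :
    A.IsResolventAt z (A.resolvent z) := by
  rw [resolvent, dif_pos (show ∃ R : X →L[ℂ] X, A.IsResolventAt z R from h)]
  exact Exists.choose_spec (show ∃ R : X →L[ℂ] X, A.IsResolventAt z R from h)

theorem neg_mem_resolventSet_neg {A : X →ₗ.[ℂ] X} {z : ℂ} (h : -z ∈ A.resolventSet) :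
    z ∈ (-A).resolventSet := by
  obtain ⟨R, hR1, hR2⟩ := h
  refine ⟨-R, fun x => ?_, fun x => ?_⟩
  · obtain ⟨hx, h⟩ := hR1 (-x)
    have hx' : (-R) x ∈ A.domain := by simpa using hx
    refine ⟨hx', ?_⟩
    have h1 : (⟨(-R) x, hx'⟩ : A.domain) = ⟨R (-x), hx⟩ := by
      ext
      simp
    rw [LinearPMap.neg_apply]
    change z • (-R) x - -(A ⟨(-R) x, hx'⟩) = x
    rw [h1]
    have h2 : (-R) x = R (-x) := by simp
    have h3 := congrArg Neg.neg h
    rw [h2]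
    rw [neg_neg] at h3
    refine Eq.trans ?_ h3
    rw [neg_smul]
    abel
  · have h := hR2 x
    change (-R) (z • (x : X) - -(A x)) = x
    rw [_root_.neg_apply, ← _root_.map_neg]
    rw [← h]
    congr 1
    rw [h, neg_smul]
    abel

/-- The resolvent identity. -/
theorem resolvent_sub_apply {A : X →ₗ.[ℂ] X} {z w : ℂ} (hz : z ∈ A.resolventSet)
    (hw : w ∈ A.resolventSet) (x : X) :
    A.resolvent z x - A.resolvent w x = (w - z) • A.resolvent z (A.resolvent w x) := by
  obtain ⟨h, hx⟩ := (isResolventAt_resolvent hw).1 x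
  have h2 := (isResolventAt_resolvent hz).2 ⟨A.resolvent w x, h⟩
  have h3 : z • A.resolvent w x - A ⟨A.resolvent w x, h⟩ = x - (w - z) • A.resolvent w x := by
    refine Eq.trans ?_ (congrArg (fun v => v - (w - z) • A.resolvent w x) hx)
    simp only [sub_smul]
    abel
  simp only at h2
  rw [h3, _root_.map_sub, ContinuousLinearMap.map_smul] at h2
  rw [sub_eq_iff_eq_add, ← sub_eq_iff_eq_add']
  exact h2

/-- In `R(z) = R(w) + (w - z) R(z) R(w)` the last term has norm at most half that of `R(z)` and is
absorbed on the left. This is the local boundedness behind strong continuity. -/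
theorem norm_resolvent_le {A : X →ₗ.[ℂ] X} {z w : ℂ} (hz : z ∈ A.resolventSet)
    (hw : w ∈ A.resolventSet) (h : ‖w - z‖ * ‖A.resolvent w‖ ≤ 1 / 2) :
    ‖A.resolvent z‖ ≤ 2 * ‖A.resolvent w‖ := by
  have h1 : A.resolvent z = A.resolvent w + (w - z) • (A.resolvent z ∘L A.resolvent w) := by
    ext x
    have := resolvent_sub_apply hz hw x
    rw [sub_eq_iff_eq_add'] at this
    simpa using this
  have h2 : ‖A.resolvent z‖ ≤ ‖A.resolvent w‖ + ‖w - z‖ * (‖A.resolvent z‖ * ‖A.resolvent w‖) := by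
    calc ‖A.resolvent z‖ = ‖A.resolvent w + (w - z) • (A.resolvent z ∘L A.resolvent w)‖ := by
          rw [← h1]
      _ ≤ ‖A.resolvent w‖ + ‖(w - z) • (A.resolvent z ∘L A.resolvent w)‖ := norm_add_le _ _
      _ ≤ _ := by
        rw [norm_smul]
        gcongr
        exact ContinuousLinearMap.opNorm_comp_le _ _
  nlinarith [norm_nonneg (A.resolvent z)]

theorem continuousOn_resolvent {A : X →ₗ.[ℂ] X} {U : Set ℂ} (hA : U ⊆ A.resolventSet)
    (x : X) : ContinuousOn (fun z => A.resolvent z x) U := by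
  intro w hw
  rw [ContinuousWithinAt, tendsto_iff_norm_sub_tendsto_zero]
  have hlim : Tendsto (fun z : ℂ => ‖w - z‖) (𝓝[U] w) (𝓝 0) := by
    have : Tendsto (fun z : ℂ => ‖w - z‖) (𝓝 w) (𝓝 ‖w - w‖) :=
      Continuous.tendsto (by fun_prop) w
    rw [sub_self, norm_zero] at this
    exact this.mono_left nhdsWithin_le_nhds
  have hlim2 : Tendsto (fun z : ℂ => ‖w - z‖ * ‖A.resolvent w‖) (𝓝[U] w) (𝓝 0) := by
    simpa using hlim.mul_const ‖A.resolvent w‖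
  have hlim3 : Tendsto (fun z : ℂ => ‖w - z‖ * (2 * ‖A.resolvent w‖ * ‖A.resolvent w x‖))
      (𝓝[U] w) (𝓝 0) := by
    simpa using hlim.mul_const (2 * ‖A.resolvent w‖ * ‖A.resolvent w x‖)
  refine squeeze_zero' (Eventually.of_forall fun z => norm_nonneg _) ?_ hlim3
  filter_upwards [self_mem_nhdsWithin, hlim2.eventually_le_const (show (0 : ℝ) < 1 / 2 by norm_num)]
    with z hz hzs
  rw [resolvent_sub_apply (hA hz) (hA hw), norm_smul]
  gcongr
  exact (ContinuousLinearMap.le_opNorm _ _).trans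
    (mul_le_mul_of_nonneg_right (norm_resolvent_le (hA hz) (hA hw) hzs) (norm_nonneg _))

/-- By the resolvent identity the difference quotient is exactly `-R(z) R(w) x`, which converges by
strong continuity applied to the vector `R(w) x`. -/
theorem differentiableOn_resolvent {A : X →ₗ.[ℂ] X} {U : Set ℂ} (hA : U ⊆ A.resolventSet)
    (x : X) : DifferentiableOn ℂ (fun z => A.resolvent z x) U := by
  intro w hw
  have hd : HasDerivWithinAt (fun z => A.resolvent z x) (-A.resolvent w (A.resolvent w x)) U w := by
    rw [hasDerivWithinAt_iff_tendsto_slope]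
    have hc := ((continuousOn_resolvent hA (A.resolvent w x)) w hw).neg
    refine Tendsto.congr' ?_ (hc.tendsto.mono_left (nhdsWithin_mono _ sdiff_subset))
    filter_upwards [self_mem_nhdsWithin] with z hz
    have hne : z - w ≠ 0 := sub_ne_zero.2 hz.2
    rw [slope_def_module, resolvent_sub_apply (hA hz.1) (hA hw), smul_smul,
      show (z - w)⁻¹ * (w - z) = -1 by rw [← neg_sub z w]; field_simp, neg_one_smul]
    rfl
  exact hd.differentiableWithinAt

end LinearPMap

/-! ### Joint continuity of the semigroup, and the resolvent as its Laplace transform. -/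

namespace C0Semigroup

variable {X : Type*} [NormedAddCommGroup X] [NormedSpace ℂ X]

/-- Joint continuity of a semigroup. -/
theorem continuousOn_apply (T : C0Semigroup X) {w M : ℝ}
    (hM : ∀ t : ℝ, 0 ≤ t → ‖T t‖ ≤ M * Real.exp (w * t)) :
    ContinuousOn (fun z : ℝ × X => T z.1 z.2) (Ici 0 ×ˢ univ) := by
  rintro ⟨t, x⟩ ⟨ht, -⟩
  have h1 : Tendsto (fun z : ℝ × X => T z.1 (z.2 - x)) (𝓝[Ici 0 ×ˢ univ] (t, x)) (𝓝 0) := by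
    have hlim : Tendsto (fun z : ℝ × X => M * Real.exp (w * z.1) * ‖z.2 - x‖)
        (𝓝[Ici 0 ×ˢ univ] (t, x)) (𝓝 0) := by
      have : Tendsto (fun z : ℝ × X => M * Real.exp (w * z.1) * ‖z.2 - x‖) (𝓝 (t, x))
          (𝓝 (M * Real.exp (w * t) * ‖x - x‖)) := Continuous.tendsto (by fun_prop) (t, x)
      rw [sub_self, norm_zero, mul_zero] at this
      exact this.mono_left nhdsWithin_le_nhds
    refine squeeze_zero_norm' ?_ hlim
    filter_upwards [self_mem_nhdsWithin] with z hz
    exact ((T z.1).le_opNorm _).trans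
      (mul_le_mul_of_nonneg_right (hM _ hz.1) (norm_nonneg _))
  have h2 : Tendsto (fun z : ℝ × X => T z.1 x) (𝓝[Ici 0 ×ˢ univ] (t, x)) (𝓝 (T t x)) := by
    refine ((T.continuousOn_orbit x) t ht).tendsto.comp ?_
    refine tendsto_nhdsWithin_iff.2 ⟨(continuous_fst.tendsto (t, x)).mono_left
      nhdsWithin_le_nhds, ?_⟩
    filter_upwards [self_mem_nhdsWithin] with z hz using hz.1
  have h3 := h1.add h2
  rw [zero_add] at h3
  refine h3.congr fun z => ?_
  rw [map_sub, sub_add_cancel]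

/-- The resolvent of the generator is the Laplace transform of the semigroup, on every vector for
which the Laplace integral converges absolutely. -/
theorem resolvent_eq_integral [CompleteSpace X] (T : C0Semigroup X) {B : X →ₗ.[ℂ] X}
    (hB : T.IsGenerator B) {z : ℂ} (hz : z ∈ B.resolventSet) {x : X}
    (hint : IntegrableOn (fun t : ℝ => Complex.exp (-(z * t)) • T t x) (Ioi 0)) :
    B.resolvent z x = ∫ t in Ioi (0 : ℝ), Complex.exp (-(z * t)) • T t x := by
  set F : ℝ → X := fun t => Complex.exp (-(z * t)) • T t x with hF
  set y := ∫ t in Ioi (0 : ℝ), F t with hy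
  have hcont : ContinuousOn F (Ici 0) :=
    ContinuousOn.smul (Continuous.continuousOn (by fun_prop)) (T.continuousOn_orbit x)
  -- The semigroup law turns `T h` on the Laplace integral into a translation by `h`, which cuts off
  -- the piece over `(0, h]`.
  have hT : ∀ h : ℝ, 0 < h → T h y = Complex.exp (z * h) • (y - ∫ t in (0 : ℝ)..h, F t) := by
    intro h hh
    have h1 : T h y = ∫ t in Ioi (0 : ℝ), Complex.exp (z * h) • F (t + h) := by
      rw [hy, ← ContinuousLinearMap.integral_comp_comm _ hint]
      refine setIntegral_congr_fun measurableSet_Ioi fun t ht => ?_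
      have ht' : (0 : ℝ) < t := ht
      simp only [hF]
      rw [map_smul, add_comm t h, T.map_add h t hh.le ht'.le, ContinuousLinearMap.comp_apply,
        smul_smul, ← Complex.exp_add]
      congr 2
      push_cast
      ring
    have h2 := (measurePreserving_add_right volume h).setIntegral_preimage_emb
      (measurableEmbedding_addRight h) F (Ioi h)
    rw [preimage_add_const_Ioi, sub_self] at h2
    rw [h1, integral_smul, h2, ← intervalIntegral.integral_Ioi_sub_Ioi hint hh.le]
    congr 1
    rw [hy]
    abel
  have hder : Tendsto (fun h : ℝ => (h : ℂ)⁻¹ • ∫ t in (0 : ℝ)..h, F t) (𝓝[>] 0) (𝓝 x) := by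
    have hd : HasDerivWithinAt (fun s => ∫ t in (0 : ℝ)..s, F t) (F 0) (Ici 0) 0 := by
      refine intervalIntegral.integral_hasDerivWithinAt_right (by simp) ?_
        (hcont 0 self_mem_Ici |>.mono Ioi_subset_Ici_self)
      exact (hcont.mono Ioi_subset_Ici_self).stronglyMeasurableAtFilter_nhdsWithin
        measurableSet_Ioi 0
    rw [hasDerivWithinAt_iff_tendsto_slope, Ici_sdiff_left] at hd
    have hF0 : F 0 = x := by simp [hF, T.map_zero]
    rw [hF0] at hd
    refine hd.congr fun h => ?_
    rw [slope_def_module, intervalIntegral.integral_same, sub_zero, sub_zero, ← Complex.coe_smul,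
      Complex.ofReal_inv]
  have hexp : Tendsto (fun h : ℝ => (h : ℂ)⁻¹ * (Complex.exp (z * h) - 1)) (𝓝[>] 0) (𝓝 z) := by
    have hd : HasDerivAt (fun h : ℝ => Complex.exp (z * h)) z 0 := by
      have h1 : HasDerivAt (fun h : ℝ => z * (h : ℂ)) (z * 1) 0 :=
        (Complex.ofRealCLM.hasDerivAt (x := (0 : ℝ))).const_mul z
      simpa using h1.cexp
    have h2 := (hasDerivAt_iff_tendsto_slope.1 hd).mono_left
      (nhdsWithin_mono (0 : ℝ) (fun h (hh : 0 < h) => hh.ne') : 𝓝[>] (0 : ℝ) ≤ _)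
    refine h2.congr fun h => ?_
    rw [slope_def_module, sub_zero, ← Complex.coe_smul, Complex.ofReal_inv]
    simp
  have hexp1 : Tendsto (fun h : ℝ => Complex.exp (z * h)) (𝓝[>] 0) (𝓝 1) := by
    have : Tendsto (fun h : ℝ => Complex.exp (z * h)) (𝓝 0) (𝓝 (Complex.exp (z * (0 : ℝ)))) :=
      Continuous.tendsto (by fun_prop) 0
    simp only [Complex.ofReal_zero, mul_zero, Complex.exp_zero] at this
    exact this.mono_left nhdsWithin_le_nhds
  -- Dividing `T h y - y = (e^{zh} - 1) y - e^{zh} ∫₀ʰ F` by `h` and letting `h ↓ 0` identifies `B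
  -- y` as `z y - x`.
  have hgen : (y, z • y - x) ∈ B.graph := by
    rw [hB]
    have h1 := (hexp.smul_const y).sub (hexp1.smul hder)
    rw [one_smul] at h1
    refine h1.congr' ?_
    filter_upwards [self_mem_nhdsWithin] with h hh
    rw [hT h hh, mul_smul, ← smul_comm (h : ℂ)⁻¹, ← smul_sub]
    congr 1
    rw [sub_smul, smul_sub, one_smul]
    abel
  obtain ⟨⟨y', hy'⟩, h1, h2⟩ := (LinearPMap.mem_graph_iff B).1 hgen
  simp only at h1 h2
  obtain rfl := h1
  have h3 := (LinearPMap.isResolventAt_resolvent hz).2 ⟨_, hy'⟩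
  rw [h2, sub_sub_cancel] at h3
  exact h3

end C0Semigroup

/-! ### Multiplier operators on Schwartz functions and on elementary tensors. -/

namespace FourierMult

open FourierTransform

variable {Y X : Type*} [NormedAddCommGroup Y] [NormedSpace ℂ Y]
  [NormedAddCommGroup X] [NormedSpace ℂ X]

theorem fourierHat_eq_fourier (f : ℝ → Y) (ξ : ℝ) :
    fourierHat f ξ = 𝓕 f (ξ / (2 * Real.pi)) := by
  rw [fourierHat, Real.fourier_real_eq_integral_exp_smul]
  refine integral_congr_ae (Eventually.of_forall fun t => ?_)
  simp only
  congr 2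
  push_cast
  field_simp

theorem fourierHat_schwartz (f : 𝓢(ℝ, Y)) (ξ : ℝ) :
    fourierHat f ξ = (𝓕 f : 𝓢(ℝ, Y)) (ξ / (2 * Real.pi)) := by
  rw [fourierHat_eq_fourier, SchwartzMap.fourier_coe]

theorem continuous_fourierHat (f : 𝓢(ℝ, Y)) : Continuous (fourierHat f) := by
  simp_rw [funext (fourierHat_schwartz f)]
  exact (𝓕 f : 𝓢(ℝ, Y)).continuous.comp (by fun_prop)

theorem fourierHat_decay (f : 𝓢(ℝ, Y)) (k : ℕ) :
    ∃ C : ℝ, 0 ≤ C ∧ ∀ ξ : ℝ, (1 + |ξ|) ^ k * ‖fourierHat f ξ‖ ≤ C := by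
  set g := (𝓕 f : 𝓢(ℝ, Y))
  have hb := SchwartzMap.one_add_le_sup_seminorm_apply (𝕜 := ℂ) (m := (k, 0)) le_rfl le_rfl g
  set S := 2 ^ k * ((Finset.Iic (k, 0)).sup fun m => SchwartzMap.seminorm ℂ m.1 m.2) g with hS
  have hS0 : 0 ≤ S := by
    refine le_trans ?_ (hb 0)
    positivity
  refine ⟨(2 * Real.pi) ^ k * S, by positivity, fun ξ => ?_⟩
  have h1 := hb (ξ / (2 * Real.pi))
  rw [norm_iteratedFDeriv_zero] at h1
  rw [fourierHat_schwartz]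
  have h2 : 1 + |ξ| ≤ 2 * Real.pi * (1 + ‖ξ / (2 * Real.pi)‖) := by
    have h3 := Real.pi_gt_three
    rw [norm_div, Real.norm_eq_abs, Real.norm_of_nonneg (by positivity : (0 : ℝ) ≤ 2 * Real.pi),
      mul_add, mul_div_cancel₀ _ (by positivity)]
    linarith
  calc (1 + |ξ|) ^ k * ‖g (ξ / (2 * Real.pi))‖
      ≤ (2 * Real.pi * (1 + ‖ξ / (2 * Real.pi)‖)) ^ k * ‖g (ξ / (2 * Real.pi))‖ := by gcongr
    _ = (2 * Real.pi) ^ k * ((1 + ‖ξ / (2 * Real.pi)‖) ^ k * ‖g (ξ / (2 * Real.pi))‖) := by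
        rw [mul_pow]; ring
    _ ≤ _ := by gcongr

theorem integrable_fourierHat (f : 𝓢(ℝ, Y)) : Integrable (fourierHat f) := by
  simp_rw [funext (fourierHat_schwartz f)]
  exact (𝓕 f : 𝓢(ℝ, Y)).integrable.comp_div (by positivity)

theorem fourierHat_inversion [CompleteSpace Y] (f : 𝓢(ℝ, Y)) (t : ℝ) :
    ∫ ξ : ℝ, Complex.exp (Complex.I * ξ * t) • fourierHat f ξ = ((2 * Real.pi : ℝ) : ℂ) • f t := by
  have h1 : f t = 𝓕⁻ (𝓕 (f : ℝ → Y)) t := by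
    rw [f.continuous.fourierInv_fourier_eq f.integrable (𝓕 f : 𝓢(ℝ, Y)).integrable]
  have h2 : (fun ξ : ℝ => Complex.exp (Complex.I * ξ * t) • fourierHat f ξ) = fun ξ : ℝ =>
      (fun v : ℝ => Complex.exp (((2 * Real.pi * v * t : ℝ) : ℂ) * Complex.I) • 𝓕 (f : ℝ → Y) v)
        (ξ / (2 * Real.pi)) := by
    ext ξ
    rw [fourierHat_eq_fourier]
    congr 2
    push_cast
    field_simp
  rw [h2, Measure.integral_comp_div (fun v : ℝ =>
    Complex.exp (((2 * Real.pi * v * t : ℝ) : ℂ) * Complex.I) • 𝓕 (f : ℝ → Y) v), h1, Real.fourierInv_eq',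
    abs_of_pos (by positivity), Complex.coe_smul]
  congr 1
  refine integral_congr_ae (Eventually.of_forall fun v => ?_)
  simp only
  congr 4
  simp
  ring

/-- A multiplier that is the Fourier transform of an operator-valued kernel acts as convolution. -/
theorem multOp_eq_convolution [CompleteSpace Y] [CompleteSpace X] {m K : ℝ → Y →L[ℂ] X}
    {k : ℝ → ℝ}
    (hk : Integrable k) (hK : ∀ s, ‖K s‖ ≤ k s)
    (hmeas : ∀ g : ℝ → Y, Continuous g →
      AEStronglyMeasurable (fun z : ℝ × ℝ => K z.1 (g z.2)) (volume.prod volume))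
    (hm : ∀ ξ y, m ξ y = fourierHat (fun s => K s y) ξ) (f : 𝓢(ℝ, Y)) (t : ℝ) :
    multOp m f t = ∫ s : ℝ, K s (f (t - s)) := by
  -- Fubini is justified by the product majorant `k(s) ‖f̂(ξ)‖`.
  have hint : Integrable (fun z : ℝ × ℝ => Complex.exp (Complex.I * z.2 * (t - z.1 : ℝ)) •
      K z.1 (fourierHat f z.2)) (volume.prod volume) := by
    refine Integrable.mono' (hk.mul_prod (integrable_fourierHat f).norm) ?_ ?_
    · refine AEStronglyMeasurable.smul ?_ (hmeas _ (continuous_fourierHat f))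
      exact Continuous.aestronglyMeasurable (by fun_prop)
    · refine Eventually.of_forall fun z => ?_
      rw [norm_smul, mul_assoc, mul_comm Complex.I, ← Complex.ofReal_mul,
        Complex.norm_exp_ofReal_mul_I, one_mul]
      exact ((K z.1).le_opNorm _).trans (mul_le_mul_of_nonneg_right (hK _) (norm_nonneg _))
  have hsec : ∀ s : ℝ, Integrable (fun ξ : ℝ => Complex.exp (Complex.I * ξ * (t - s : ℝ)) •
      fourierHat f ξ) := by
    intro s
    refine (integrable_fourierHat f).norm.mono' ?_ (Eventually.of_forall fun ξ => ?_)
    · exact (Continuous.smul (by fun_prop) (continuous_fourierHat f)).aestronglyMeasurable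
    · rw [norm_smul, mul_assoc, mul_comm Complex.I, ← Complex.ofReal_mul,
        Complex.norm_exp_ofReal_mul_I, one_mul]
  have h1 : ∀ ξ : ℝ, Complex.exp (Complex.I * ξ * t) • m ξ (fourierHat f ξ) =
      ∫ s : ℝ, Complex.exp (Complex.I * ξ * (t - s : ℝ)) • K s (fourierHat f ξ) := by
    intro ξ
    rw [hm, fourierHat, ← integral_smul]
    refine integral_congr_ae (Eventually.of_forall fun s => ?_)
    simp only
    rw [smul_smul, ← Complex.exp_add]
    congr 2
    push_cast
    ring
  rw [multOp]
  simp_rw [h1]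
  rw [← integral_integral_swap hint, ← integral_smul]
  refine integral_congr_ae (Eventually.of_forall fun s => ?_)
  simp only
  simp_rw [← map_smul]
  -- For fixed `s` the bounded operator `K s` comes out of the `ξ`-integral, and Fourier inversion
  -- leaves `2π f(t - s)`.
  rw [ContinuousLinearMap.integral_comp_comm _ (hsec s), fourierHat_inversion, map_smul, smul_smul,
    inv_mul_cancel₀ (Complex.ofReal_ne_zero.2 (by positivity)), one_smul]

/-- The elementary tensor `s ↦ φ(s) y`. -/
noncomputable def tensor (φ : 𝓢(ℝ, ℂ)) (y : Y) : 𝓢(ℝ, Y) :=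
  φ.postcompCLM (ContinuousLinearMap.toSpanSingleton ℂ y)

@[simp]
theorem tensor_apply (φ : 𝓢(ℝ, ℂ)) (y : Y) (s : ℝ) : tensor φ y s = φ s • y := rfl

theorem fourierHat_tensor [CompleteSpace Y] (φ : 𝓢(ℝ, ℂ)) (y : Y) (ξ : ℝ) :
    fourierHat (tensor φ y) ξ = fourierHat φ ξ • y := by
  rw [fourierHat, fourierHat, ← integral_smul_const]
  simp [smul_smul]

theorem multOp_tensor [CompleteSpace Y] (m : ℝ → Y →L[ℂ] X) (φ : 𝓢(ℝ, ℂ)) (y : Y) (t : ℝ) :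
    multOp m (tensor φ y) t = ((2 * Real.pi : ℝ) : ℂ)⁻¹ •
      ∫ ξ : ℝ, (Complex.exp (Complex.I * ξ * t) * fourierHat φ ξ) • m ξ y := by
  rw [multOp]
  simp_rw [fourierHat_tensor, map_smul, smul_smul]

/-- On a tensor only the single vector `y` matters, so the convolution theorem is applied with `ℂ`
in place of `Y`. Integrability of `K(·) y` then suffices; no integrable majorant of the operator
norm is needed. -/
theorem multOp_tensor_eq_convolution [CompleteSpace Y] [CompleteSpace X] {m : ℝ → Y →L[ℂ] X}
    {k : ℝ → X} {y : Y} (hk : Integrable k) (hm : ∀ ξ, m ξ y = fourierHat k ξ)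
    (φ : 𝓢(ℝ, ℂ)) (t : ℝ) :
    multOp m (tensor φ y) t = ∫ s : ℝ, φ (t - s) • k s := by
  have h := multOp_eq_convolution
    (m := fun ξ => ContinuousLinearMap.toSpanSingleton ℂ (m ξ y))
    (K := fun s => ContinuousLinearMap.toSpanSingleton ℂ (k s)) hk.norm
    (fun s => (ContinuousLinearMap.norm_toSpanSingleton _).le)
    (fun g hg => by
      simp only [ContinuousLinearMap.toSpanSingleton_apply]
      exact (hg.comp continuous_snd).aestronglyMeasurable.smul
        (hk.aestronglyMeasurable.comp_fst))
    (fun ξ c => by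
      simp only [ContinuousLinearMap.toSpanSingleton_apply]
      rw [hm, fourierHat, fourierHat, ← integral_smul]
      simp_rw [smul_smul, mul_comm]) φ t
  simp only [ContinuousLinearMap.toSpanSingleton_apply] at h
  rw [multOp_tensor, ← h, multOp]
  simp_rw [ContinuousLinearMap.toSpanSingleton_apply, smul_smul]

/-- The rapid decay of `θ` absorbs the polynomial weight `(1 + |ξ|)^κ`, once `κ` is rounded up to an
integer. -/
theorem integrable_smul_of_isModerate {m : ℝ → Y →L[ℂ] X} (hm : IsStronglyMeas m)
    (hmod : IsModerate m) {θ : ℝ → ℂ} (hθ : Continuous θ)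
    (hdecay : ∀ k : ℕ, ∃ C : ℝ, 0 ≤ C ∧ ∀ ξ : ℝ, (1 + |ξ|) ^ k * ‖θ ξ‖ ≤ C) (y : Y) :
    Integrable (fun ξ => θ ξ • m ξ y) := by
  obtain ⟨κ, hκ, g, hg, hmg⟩ := hmod
  obtain ⟨k, hk⟩ := exists_nat_ge κ
  obtain ⟨C, hC0, hC⟩ := hdecay k
  refine (hg.mul_const (C * ‖y‖)).mono' (hθ.aestronglyMeasurable.smul (hm y).aestronglyMeasurable)
    (Eventually.of_forall fun ξ => ?_)
  have h0 : (0 : ℝ) < 1 + |ξ| := by positivity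
  have h1 : ‖m ξ‖ ≤ (1 + |ξ|) ^ κ * g ξ := by
    have := mul_le_mul_of_nonneg_left (hmg ξ) (Real.rpow_nonneg h0.le κ)
    rwa [← mul_assoc, ← Real.rpow_add h0, add_neg_cancel, Real.rpow_zero, one_mul] at this
  have h2 : (1 + |ξ|) ^ κ ≤ (1 + |ξ|) ^ k := by
    rw [← Real.rpow_natCast]
    exact Real.rpow_le_rpow_of_exponent_le (by linarith [abs_nonneg ξ]) hk
  have hg0 : 0 ≤ g ξ := le_trans (by positivity) (hmg ξ)
  calc ‖θ ξ • m ξ y‖ = ‖θ ξ‖ * ‖m ξ y‖ := norm_smul _ _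
    _ ≤ ‖θ ξ‖ * (((1 + |ξ|) ^ k * g ξ) * ‖y‖) := by
        gcongr
        exact ((m ξ).le_opNorm y).trans (by gcongr; exact h1.trans (by gcongr))
    _ = ((1 + |ξ|) ^ k * ‖θ ξ‖) * (g ξ * ‖y‖) := by ring
    _ ≤ C * (g ξ * ‖y‖) := by gcongr; exact hC ξ
    _ = _ := by ring

theorem integrable_fourierHat_smul {m : ℝ → Y →L[ℂ] X} (hm : IsStronglyMeas m)
    (hmod : IsModerate m) (φ : 𝓢(ℝ, ℂ)) (y : Y) (t : ℝ) :
    Integrable (fun ξ : ℝ => (Complex.exp (Complex.I * ξ * t) * fourierHat φ ξ) • m ξ y) := by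
  refine integrable_smul_of_isModerate hm hmod
    (Continuous.mul (by fun_prop) (continuous_fourierHat φ)) (fun k => ?_) y
  obtain ⟨C, hC0, hC⟩ := fourierHat_decay φ k
  refine ⟨C, hC0, fun ξ => ?_⟩
  rw [Pi.mul_apply, norm_mul, mul_assoc Complex.I, mul_comm Complex.I, ← Complex.ofReal_mul,
    Complex.norm_exp_ofReal_mul_I, one_mul]
  exact hC ξ

theorem continuous_multOp_tensor [CompleteSpace Y] {m : ℝ → Y →L[ℂ] X} (hm : IsStronglyMeas m)
    (hmod : IsModerate m) (φ : 𝓢(ℝ, ℂ)) (y : Y) : Continuous (multOp m (tensor φ y)) := by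
  rw [funext (multOp_tensor m φ y)]
  refine Continuous.const_smul ?_ _
  have hint := integrable_fourierHat_smul hm hmod φ y
  refine continuous_of_dominated (fun t => (hint t).aestronglyMeasurable)
    (bound := fun ξ => ‖fourierHat φ ξ • m ξ y‖) (fun t => Eventually.of_forall fun ξ => ?_) ?_
    (Eventually.of_forall fun ξ => ?_)
  · rw [norm_smul, norm_smul, norm_mul, mul_assoc Complex.I, mul_comm Complex.I,
      ← Complex.ofReal_mul, Complex.norm_exp_ofReal_mul_I, one_mul]
  · simpa using (hint 0).norm
  · exact Continuous.smul (by fun_prop) continuous_const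

end FourierMult

/-! ### Passing from the test functions of the definition to finite sums of tensors. -/

namespace FourierMult

variable {Y X : Type*} [NormedAddCommGroup Y] [NormedSpace ℂ Y]
  [NormedAddCommGroup X] [NormedSpace ℂ X]

/-- Bounded measurable real functions are uniform limits of simple functions. -/
theorem exists_simpleFunc_near {f : ℝ → ℝ} (hf : Measurable f) {B : ℝ} (hB : ∀ s, |f s| ≤ B)
    {ε : ℝ} (hε : 0 < ε) : ∃ ψ : SimpleFunc ℝ ℝ, ∀ s, |f s - ψ s| ≤ ε := by
  -- Rounding `f / ε` down to an integer takes finitely many values, because `f` is bounded.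
  have hfin : (range fun s => (⌊f s / ε⌋ : ℤ)).Finite := by
    refine (Set.finite_Icc ⌊-B / ε⌋ ⌊B / ε⌋).subset ?_
    rintro _ ⟨s, rfl⟩
    have := abs_le.1 (hB s)
    exact ⟨Int.floor_le_floor (by gcongr; exact this.1), Int.floor_le_floor (by gcongr; exact this.2)⟩
  have hmeas : Measurable fun s => (⌊f s / ε⌋ : ℤ) := Int.measurable_floor.comp (hf.div_const ε)
  let ψ₀ : SimpleFunc ℝ ℤ :=
    ⟨fun s => ⌊f s / ε⌋, fun x => hmeas (measurableSet_singleton x), hfin⟩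
  refine ⟨ψ₀.map fun n : ℤ => ε * n, fun s => ?_⟩
  have h1 : (ψ₀.map fun n : ℤ => ε * n) s = ε * (⌊f s / ε⌋ : ℤ) := rfl
  have h2 : f s = ε * (f s / ε) := by field_simp
  have h3 := Int.floor_le (f s / ε)
  have h4 := Int.lt_floor_add_one (f s / ε)
  rw [h1, h2, ← mul_sub, ← h2, abs_mul, abs_of_pos hε, abs_of_nonneg (by linarith)]
  nlinarith

theorem exists_simpleFunc_near_complex {f : ℝ → ℂ} (hf : Measurable f) {B : ℝ}
    (hB : ∀ s, ‖f s‖ ≤ B) {ε : ℝ} (hε : 0 < ε) :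
    ∃ ψ : SimpleFunc ℝ ℂ, ∀ s, ‖f s - ψ s‖ ≤ ε := by
  obtain ⟨u, hu⟩ := exists_simpleFunc_near (Complex.measurable_re.comp hf)
    (fun s => (Complex.abs_re_le_norm (f s)).trans (hB s)) (half_pos hε)
  obtain ⟨v, hv⟩ := exists_simpleFunc_near (Complex.measurable_im.comp hf)
    (fun s => (Complex.abs_im_le_norm (f s)).trans (hB s)) (half_pos hε)
  refine ⟨(u.pair v).map fun z : ℝ × ℝ => (⟨z.1, z.2⟩ : ℂ), fun s => ?_⟩
  have h := Complex.norm_le_abs_re_add_abs_im (f s - (⟨u s, v s⟩ : ℂ))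
  have h1 := hu s
  have h2 := hv s
  simp only [Complex.sub_re, Complex.sub_im, Function.comp_apply] at h h1 h2
  change ‖f s - (⟨u s, v s⟩ : ℂ)‖ ≤ ε
  linarith

theorem exists_simpleFunc_sum {ι : Type*} (S : Finset ι) (ψ : ι → SimpleFunc ℝ ℂ) (y : ι → Y) :
    ∃ F : SimpleFunc ℝ Y, ∀ s, F s = ∑ i ∈ S, ψ i s • y i := by
  classical
  induction S using Finset.induction_on with
  | empty => exact ⟨0, fun s => by simp⟩
  | insert i S hi ih =>
    obtain ⟨F, hF⟩ := ih
    refine ⟨(ψ i).map (fun c => c • y i) + F, fun s => ?_⟩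
    rw [Finset.sum_insert hi, ← hF]
    rfl

/-- For `p = q = ∞` the bound is known on simple functions only. Each scalar factor is uniformly
close to a simple function, and since `K(·) y` is integrable for each of the finitely many vectors,
the output changes uniformly little as well. -/
theorem eLpNorm_top_sum_tensor_le [CompleteSpace Y] [CompleteSpace X] {m K : ℝ → Y →L[ℂ] X}
    (hK : IsKernel K m) {C : ℝ} (hC0 : 0 ≤ C)
    (hC : ∀ f : SimpleFunc ℝ Y, eLpNorm (fun t : ℝ => ∫ s : ℝ, K (t - s) (f s)) ∞ volume ≤
        ENNReal.ofReal C * eLpNorm f ∞ volume)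
    {ι : Type*} [Fintype ι] (φ : ι → 𝓢(ℝ, ℂ)) (y : ι → Y) :
    eLpNorm (fun t => ∑ i, multOp m (tensor (φ i) (y i)) t) ∞ volume ≤
      ENNReal.ofReal C * eLpNorm (fun s => ∑ i, φ i s • y i) ∞ volume := by
  set E : ℝ := ∑ i, ‖y i‖
  set D : ℝ := ∑ i, ∫ s : ℝ, ‖K s (y i)‖
  have hE : 0 ≤ E := Finset.sum_nonneg fun i _ => norm_nonneg _
  have hD : 0 ≤ D := Finset.sum_nonneg fun i _ => integral_nonneg fun s => norm_nonneg _
  set N := eLpNorm (fun s => ∑ i, φ i s • y i) ∞ volume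
  -- The error `C * E * ε` comes from the change of the input norm, and `D * ε` from the change of
  -- the output.
  have key : ∀ ε : ℝ, 0 < ε → eLpNorm (fun t => ∑ i, multOp m (tensor (φ i) (y i)) t) ∞ volume ≤
      ENNReal.ofReal C * N + ENNReal.ofReal ((C * E + D) * ε) := by
    intro ε hε
    have hbd : ∀ i, ∃ B : ℝ, ∀ s, ‖φ i s‖ ≤ B := fun i => by
      obtain ⟨B, -, hB⟩ := (φ i).decay 0 0
      exact ⟨B, fun s => by simpa using hB s⟩
    choose B hB using hbd
    choose ψ hψ using fun i => exists_simpleFunc_near_complex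
      (φ i).continuous.measurable (hB i) hε
    obtain ⟨F, hF⟩ := exists_simpleFunc_sum Finset.univ ψ y
    have hFN : eLpNorm F ∞ volume ≤ N + ENNReal.ofReal (E * ε) := by
      have h1 : ∀ᵐ s : ℝ, ‖∑ i, φ i s • y i‖ₑ ≤ N := ae_le_eLpNormEssSup
      refine eLpNormEssSup_le_of_ae_enorm_bound ?_
      filter_upwards [h1] with s hs
      have h2 : F s = (∑ i, φ i s • y i) + ∑ i, (ψ i s - φ i s) • y i := by
        rw [hF, ← Finset.sum_add_distrib]
        refine Finset.sum_congr rfl fun i _ => ?_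
        rw [sub_smul]
        abel
      rw [h2]
      refine (enorm_add_le _ _).trans (add_le_add hs ?_)
      rw [← ofReal_norm]
      refine ENNReal.ofReal_le_ofReal ((norm_sum_le _ _).trans ?_)
      rw [Finset.sum_mul]
      refine Finset.sum_le_sum fun i _ => ?_
      rw [norm_smul, mul_comm, norm_sub_rev]
      gcongr
      exact hψ i s
    have hu : ∀ᵐ t : ℝ, ‖∫ s : ℝ, K (t - s) (F s)‖ₑ ≤
        ENNReal.ofReal C * eLpNorm F ∞ volume := by
      filter_upwards [ae_le_eLpNormEssSup (f := fun t : ℝ => ∫ s : ℝ, K (t - s) (F s))] with t ht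
      exact ht.trans (hC F)
    refine eLpNormEssSup_le_of_ae_enorm_bound ?_
    filter_upwards [hu] with t ht
    have hKi : ∀ i, Integrable fun s => K (t - s) (y i) := fun i =>
      ((hK.2 (y i)).1).comp_sub_left t
    have hint1 : ∀ i, Integrable fun s => φ i s • K (t - s) (y i) := fun i =>
      (hKi i).bdd_smul (B i) (φ i).continuous.aestronglyMeasurable
        (Eventually.of_forall fun s => hB i s)
    have hint2 : ∀ i, Integrable fun s => (φ i s - ψ i s) • K (t - s) (y i) := fun i =>
      (hKi i).bdd_smul ε
        ((φ i).continuous.aestronglyMeasurable.sub (ψ i).aestronglyMeasurable)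
        (Eventually.of_forall fun s => hψ i s)
    have hint3 : ∀ i, Integrable fun s => ψ i s • K (t - s) (y i) := fun i => by
      refine ((hint1 i).sub (hint2 i)).congr (Eventually.of_forall fun s => ?_)
      simp only [Pi.sub_apply]
      rw [← sub_smul, sub_sub_cancel]
    have h1 : ∀ i, multOp m (tensor (φ i) (y i)) t = ∫ s, φ i s • K (t - s) (y i) := fun i => by
      rw [multOp_tensor_eq_convolution (hK.2 (y i)).1 (fun ξ => ((hK.2 (y i)).2 ξ).symm),
        ← integral_sub_left_eq_self _ volume t]
      simp only [sub_sub_cancel]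
    have h2 : ∑ i, multOp m (tensor (φ i) (y i)) t = (∫ s : ℝ, K (t - s) (F s)) +
        ∑ i, ∫ s, (φ i s - ψ i s) • K (t - s) (y i) := by
      have h3 : ∫ s : ℝ, K (t - s) (F s) = ∑ i, ∫ s, ψ i s • K (t - s) (y i) := by
        rw [← integral_finsetSum _ fun i _ => hint3 i]
        simp_rw [hF, map_sum, map_smul]
      rw [h3, ← Finset.sum_add_distrib]
      refine Finset.sum_congr rfl fun i _ => ?_
      rw [h1, ← integral_add (hint3 i) (hint2 i)]
      simp_rw [← add_smul, add_sub_cancel]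
    have h4 : ‖∑ i, ∫ s, (φ i s - ψ i s) • K (t - s) (y i)‖ ≤ D * ε := by
      refine (norm_sum_le _ _).trans ?_
      rw [Finset.sum_mul]
      refine Finset.sum_le_sum fun i _ => ?_
      rw [← integral_sub_left_eq_self (fun s => ‖K s (y i)‖) volume t, ← integral_mul_const]
      refine norm_integral_le_of_norm_le ((hKi i).norm.mul_const ε) (Eventually.of_forall fun s => ?_)
      rw [norm_smul, mul_comm]
      gcongr
      exact hψ i s
    rw [h2]
    calc _ ≤ _ := enorm_add_le _ _
      _ ≤ ENNReal.ofReal C * (N + ENNReal.ofReal (E * ε)) + ENNReal.ofReal (D * ε) := by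
          refine add_le_add (ht.trans (by gcongr)) ?_
          rw [← ofReal_norm]
          exact ENNReal.ofReal_le_ofReal h4
      _ = _ := by
          rw [mul_add, ← ENNReal.ofReal_mul hC0, add_assoc,
            ← ENNReal.ofReal_add (by positivity) (by positivity)]
          congr 2
          ring
  refine ENNReal.le_of_forall_pos_le_add fun δ hδ _ => ?_
  -- The added `1` keeps the divisor positive when `C * E + D` vanishes.
  have hpos : 0 < C * E + D + 1 := by positivity
  refine (key (δ / (C * E + D + 1)) (by positivity)).trans ?_
  gcongr
  refine ENNReal.ofReal_le_of_le_toReal ?_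
  rw [ENNReal.coe_toReal, mul_div_assoc', div_le_iff₀ hpos, mul_comm]
  exact mul_le_mul_of_nonneg_left (by linarith) δ.coe_nonneg

/-- On finite sums of elementary tensors, the bound of a multiplier applies uniformly to
all exponents. -/
theorem MultBound.eLpNorm_sum_tensor_le [CompleteSpace Y] [CompleteSpace X] {m : ℝ → Y →L[ℂ] X}
    (hm : IsStronglyMeas m) (hmod : IsModerate m) {C : ℝ} (hC0 : 0 ≤ C) {p q : ℝ≥0∞}
    (hC : MultBound p q m C) {ι : Type*} [Fintype ι] (φ : ι → 𝓢(ℝ, ℂ)) (y : ι → Y) :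
    eLpNorm (fun t => ∑ i, multOp m (tensor (φ i) (y i)) t) q volume ≤
      ENNReal.ofReal C * eLpNorm (fun s => ∑ i, φ i s • y i) p volume := by
  rcases hC with ⟨-, hC⟩ | ⟨rfl, rfl, K, hK, hC⟩
  · have h := hC (∑ i, tensor (φ i) (y i))
    have h1 : ((∑ i, tensor (φ i) (y i) : 𝓢(ℝ, Y)) : ℝ → Y) = fun s => ∑ i, φ i s • y i := by
      ext s
      rw [_root_.sum_apply]
      rfl
    have h2 : multOp m (∑ i, tensor (φ i) (y i) : 𝓢(ℝ, Y)) =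
        fun t => ∑ i, multOp m (tensor (φ i) (y i)) t := by
      ext t
      have h3 : ∀ ξ, fourierHat (∑ i, tensor (φ i) (y i) : 𝓢(ℝ, Y)) ξ =
          ∑ i, fourierHat (φ i) ξ • y i := by
        intro ξ
        simp_rw [← fourierHat_tensor, fourierHat_schwartz]
        rw [FourierTransform.fourier_sum, _root_.sum_apply]
      simp_rw [multOp_tensor]
      rw [← Finset.smul_sum, ← integral_finsetSum _ fun i _ =>
        integrable_fourierHat_smul hm hmod (φ i) (y i) t, multOp]
      simp_rw [h3, map_sum, map_smul, Finset.smul_sum, smul_smul]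
    rw [h2, h1] at h
    exact h
  · exact eLpNorm_top_sum_tensor_le hK hC0 hC φ y

end FourierMult

/-! ### Bilateral Laplace transforms and averaged horizontal integrals. -/

namespace FourierMult

open FourierTransform
open scoped ContDiff

variable {Y X : Type*} [NormedAddCommGroup Y] [NormedSpace ℂ Y]
  [NormedAddCommGroup X] [NormedSpace ℂ X]

/-- The bilateral Laplace transform. -/
noncomputable def bilap (φ : ℝ → ℂ) (z : ℂ) : ℂ :=
  ∫ s : ℝ, Complex.exp (-(z * s)) * φ s

theorem integrable_bilap {φ : ℝ → ℂ} (hφ : Continuous φ) (hc : HasCompactSupport φ) (z : ℂ) :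
    Integrable fun s : ℝ => Complex.exp (-(z * s)) * φ s :=
  Continuous.integrable_of_hasCompactSupport (by fun_prop) hc.mul_left

theorem differentiable_bilap {φ : ℝ → ℂ} (hφ : Continuous φ) (hc : HasCompactSupport φ) :
    Differentiable ℂ (bilap φ) := by
  intro z₀
  -- This dominates the `z`-derivative of the integrand on the unit ball around `z₀`; it is
  -- integrable since `φ` has compact support.
  set b : ℝ → ℝ := fun s => Real.exp ((‖z₀‖ + 1) * |s|) * |s| * ‖φ s‖ with hb
  have hbi : Integrable b :=
    Continuous.integrable_of_hasCompactSupport (by fun_prop) hc.norm.mul_left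
  have h := hasDerivAt_integral_of_dominated_loc_of_deriv_le (μ := volume) (𝕜 := ℂ)
    (F := fun (z : ℂ) (s : ℝ) => Complex.exp (-(z * s)) * φ s)
    (F' := fun (z : ℂ) (s : ℝ) => Complex.exp (-(z * s)) * (-(s : ℂ)) * φ s)
    (x₀ := z₀) (s := Metric.ball z₀ 1) (bound := b) (Metric.ball_mem_nhds z₀ one_pos)
    (Eventually.of_forall fun z => (integrable_bilap hφ hc z).aestronglyMeasurable)
    (integrable_bilap hφ hc z₀)
    (Continuous.aestronglyMeasurable (by fun_prop))
    (Eventually.of_forall fun s z hz => by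
      have hz' : ‖z‖ ≤ ‖z₀‖ + 1 := by
        have h1 := norm_sub_norm_le z z₀
        rw [Metric.mem_ball, dist_eq_norm] at hz
        linarith
      rw [norm_mul, norm_mul, norm_neg, Complex.norm_real, Real.norm_eq_abs, hb]
      simp only
      gcongr
      rw [Complex.norm_exp]
      gcongr
      refine (Complex.re_le_norm _).trans ?_
      rw [norm_neg, norm_mul, Complex.norm_real, Real.norm_eq_abs]
      gcongr) hbi
    (Eventually.of_forall fun s z _ => by
      have h1 : HasDerivAt (fun z : ℂ => -(z * s)) (-(s : ℂ)) z := by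
        have h2 := ((hasDerivAt_id z).mul_const (s : ℂ)).neg
        rw [one_mul] at h2
        exact h2
      exact h1.cexp.mul_const (φ s))
  exact h.2.differentiableAt

theorem bilap_deriv {φ : ℝ → ℂ} (hφ : ContDiff ℝ ∞ φ) (hc : HasCompactSupport φ) (z : ℂ) :
    bilap (deriv φ) z = z * bilap φ z := by
  have hφ' : Continuous (deriv φ) := hφ.continuous_deriv (by simp)
  have hd : ∀ s : ℝ, HasDerivAt (fun s : ℝ => Complex.exp (-(z * s)) * φ s)
      (Complex.exp (-(z * s)) * deriv φ s - z * (Complex.exp (-(z * s)) * φ s)) s := by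
    intro s
    have h1 : HasDerivAt (fun s : ℝ => -(z * (s : ℂ))) (-(z * 1)) s :=
      ((Complex.ofRealCLM.hasDerivAt (x := s)).const_mul z).neg
    have h2 := h1.cexp.mul ((hφ.differentiable (by simp)) s).hasDerivAt
    refine HasDerivAt.congr_deriv h2 ?_
    ring
  have h := integral_eq_zero_of_hasDerivAt_of_integrable hd
    ((integrable_bilap hφ' hc.deriv z).sub ((integrable_bilap hφ.continuous hc z).const_mul z))
    (integrable_bilap hφ.continuous hc z)
  rw [integral_sub (integrable_bilap hφ' hc.deriv z)
    ((integrable_bilap hφ.continuous hc z).const_mul z), integral_const_mul] at h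
  exact sub_eq_zero.1 h

/-- `fourierHat` uses angular frequency, so `θ` is dilated by `2π` before the inverse transform of
the Schwartz space is taken. -/
theorem exists_fourierHat_eq (θ : 𝓢(ℝ, ℂ)) : ∃ κ : 𝓢(ℝ, ℂ), ∀ ξ, fourierHat κ ξ = θ ξ := by
  have hπ : (2 * Real.pi) ≠ 0 := by positivity
  let e : ℝ ≃L[ℝ] ℝ := ContinuousLinearEquiv.unitsEquivAut ℝ (Units.mk0 (2 * Real.pi) hπ)
  let θ' : 𝓢(ℝ, ℂ) := SchwartzMap.compCLMOfContinuousLinearEquiv ℂ e θ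
  refine ⟨𝓕⁻ θ', fun ξ => ?_⟩
  rw [fourierHat_schwartz, fourier_fourierInv_eq]
  change θ (ξ / (2 * Real.pi) * (2 * Real.pi)) = θ ξ
  rw [div_mul_cancel₀ _ hπ]

/-- Translates of a test function are Fourier transforms of modulated Schwartz functions. -/
theorem exists_fourierHat_eq_translate {θ : ℝ → ℂ} (hθ : ContDiff ℝ ∞ θ)
    (hc : HasCompactSupport θ) : ∃ κ : 𝓢(ℝ, ℂ), ∀ N : ℝ, ∃ κN : 𝓢(ℝ, ℂ),
      (∀ ξ, fourierHat κN ξ = θ (ξ - N)) ∧ ∀ s, ‖κN s‖ = ‖κ s‖ := by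
  obtain ⟨κ, hκ⟩ := exists_fourierHat_eq (hc.toSchwartzMap hθ)
  refine ⟨κ, fun N => ?_⟩
  have hcN : HasCompactSupport fun ξ => θ (ξ - N) :=
    hc.comp_homeomorph (Homeomorph.subRight N)
  obtain ⟨κN, hκN⟩ := exists_fourierHat_eq
    (hcN.toSchwartzMap (hθ.comp (contDiff_id.sub contDiff_const)))
  refine ⟨κN, hκN, fun s => ?_⟩
  have h1 := fourierHat_inversion κN s
  have h2 := fourierHat_inversion κ s
  -- Translating by `N` on the Fourier side multiplies by the unimodular factor `e^{iNs}`, so the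
  -- absolute value does not depend on `N`.
  have h3 : ∫ ξ : ℝ, Complex.exp (Complex.I * ξ * s) • fourierHat κN ξ =
      Complex.exp ((N * s : ℝ) * Complex.I) *
        ∫ ξ : ℝ, Complex.exp (Complex.I * ξ * s) • fourierHat κ ξ := by
    rw [← integral_sub_right_eq_self (fun ξ : ℝ =>
      Complex.exp (Complex.I * ξ * s) • fourierHat κ ξ) N, ← integral_const_mul]
    refine integral_congr_ae (Eventually.of_forall fun ξ => ?_)
    simp only [hκ, hκN, HasCompactSupport.toSchwartzMap_toFun, smul_eq_mul]
    rw [← mul_assoc, ← Complex.exp_add]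
    congr 2
    push_cast
    ring
  rw [h1, h2, smul_eq_mul, smul_eq_mul] at h3
  have h4 := congrArg norm h3
  rw [norm_mul, norm_mul, norm_mul, Complex.norm_exp_ofReal_mul_I, one_mul] at h4
  exact mul_left_cancel₀ (by rw [norm_ne_zero_iff, Complex.ofReal_ne_zero]; positivity) h4

/-- Convolution with a bounded function supported in an interval is bounded from `L^q` to `L^∞`. -/
theorem norm_integral_smul_le {u : ℝ → X} (hu : Continuous u) {q : ℝ≥0∞} (hq : 1 ≤ q)
    {N : ℝ≥0∞} (hN : N ≠ ⊤) (huN : eLpNorm u q volume ≤ N) {g : ℝ → ℂ} {G B : ℝ}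
    (hG : ∀ s, ‖g s‖ ≤ G) (hB : ∀ s, B < |s| → g s = 0) (t : ℝ) :
    ‖∫ s : ℝ, g s • u (t - s)‖ ≤
      G * (N * volume (Icc (-B) B) ^ (1 - 1 / q.toReal)).toReal := by
  have hG0 : 0 ≤ G := (norm_nonneg _).trans (hG 0)
  have hv : Continuous fun s => u (t - s) := by fun_prop
  have h1 : eLpNorm (fun s => u (t - s)) q volume = eLpNorm u q volume :=
    eLpNorm_comp_measurePreserving hu.aestronglyMeasurable
      (Measure.measurePreserving_sub_left volume t)
  -- For `q = ∞` the conventions `∞.toReal = 0` and `1 / 0 = 0` make this exponent `1`, which is the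
  -- right Hölder exponent.
  have hexp : 0 ≤ 1 - 1 / q.toReal := by
    rcases eq_or_ne q ⊤ with rfl | hq'
    · simp
    · have : 1 ≤ q.toReal := by
        rw [← ENNReal.toReal_one]
        exact ENNReal.toReal_mono hq' hq
      rw [sub_nonneg, div_le_one (by linarith)]
      exact this
  have h2 : eLpNorm (fun s => u (t - s)) 1 (volume.restrict (Icc (-B) B)) ≤
      N * volume (Icc (-B) B) ^ (1 - 1 / q.toReal) := by
    refine (eLpNorm_le_eLpNorm_mul_rpow_measure_univ hq hv.aestronglyMeasurable).trans ?_
    rw [Measure.restrict_apply_univ, ENNReal.toReal_one, div_one]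
    gcongr
    refine le_trans ?_ huN
    rw [← h1]
    exact eLpNorm_mono_measure _ Measure.restrict_le_self
  have hint : IntegrableOn (fun s => u (t - s)) (Icc (-B) B) :=
    hv.continuousOn.integrableOn_Icc
  have h3 : ∫ s : ℝ, g s • u (t - s) = ∫ s in Icc (-B) B, g s • u (t - s) := by
    symm
    refine setIntegral_eq_integral_of_forall_compl_eq_zero fun s hs => ?_
    rw [hB s, zero_smul]
    by_contra h
    exact hs (abs_le.1 (not_lt.1 h))
  rw [h3]
  calc _ ≤ ∫ s in Icc (-B) B, G * ‖u (t - s)‖ := by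
        refine norm_integral_le_of_norm_le (hint.norm.const_mul G) (Eventually.of_forall fun s => ?_)
        rw [norm_smul]
        gcongr
        exact hG s
    _ = G * ∫ s in Icc (-B) B, ‖u (t - s)‖ := integral_const_mul _ _
    _ ≤ _ := by
        gcongr
        rw [integral_norm_eq_lintegral_enorm hint.aestronglyMeasurable,
          ← eLpNorm_one_eq_lintegral_enorm]
        refine ENNReal.toReal_mono (ENNReal.mul_ne_top hN ?_) h2
        exact ENNReal.rpow_ne_top_of_nonneg hexp (by simp)

/-- The averaged horizontal integrand of the contour shift. -/
noncomputable def avgIntegral (t : ℝ) (φ θ : ℝ → ℂ) (r : ℂ → X) (N a : ℝ) : X :=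
  ∫ ξ : ℝ, (Complex.exp ((a + Complex.I * ξ) * t) * bilap φ (a + Complex.I * ξ) * θ (ξ - N)) •
    r (a + Complex.I * ξ)

theorem integrable_avgIntegral {φ θ : ℝ → ℂ} (hφ : Continuous φ) (hφc : HasCompactSupport φ)
    (hθ : Continuous θ) (hθc : HasCompactSupport θ) {r : ℂ → X}
    (hr : ContinuousOn r {z | 0 < z.re}) (t N : ℝ) {a : ℝ} (ha : 0 < a) :
    Integrable fun ξ : ℝ => (Complex.exp ((a + Complex.I * ξ) * t) *
      bilap φ (a + Complex.I * ξ) * θ (ξ - N)) • r (a + Complex.I * ξ) := by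
  have hb := (differentiable_bilap hφ hφc).continuous
  have hr' : Continuous fun ξ : ℝ => r (a + Complex.I * ξ) :=
    hr.comp_continuous (by fun_prop) fun ξ => by simpa using ha
  have hcN : HasCompactSupport fun ξ => θ (ξ - N) :=
    hθc.comp_homeomorph (Homeomorph.subRight N)
  refine Continuous.integrable_of_hasCompactSupport (Continuous.smul (by fun_prop) hr') ?_
  exact HasCompactSupport.smul_right hcN.mul_left

theorem eLpNorm_tensor_ne_top (κ : 𝓢(ℝ, ℂ)) (y : Y) (p : ℝ≥0∞) :
    eLpNorm (tensor κ y) p volume ≠ ⊤ :=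
  ((tensor κ y).memLp p volume).2.ne

section Contour

variable [CompleteSpace Y] [CompleteSpace X]

/-- The window `θ(ξ - N)` is the Fourier transform of `κN`, and `bilap φ` on the line `Re z = a` is
that of `e^{-as} φ(s)`. By Fubini the averaged integral is therefore a convolution of the weight
with a multiplier output, and multiplier bounds apply to it. -/
theorem avgIntegral_eq {m : ℝ → Y →L[ℂ] X} {y : Y} {r : ℂ → X} {a N : ℝ} (hm : IsStronglyMeas m)
    (hmod : IsModerate m) (hmr : ∀ ξ : ℝ, m ξ y = r (a + Complex.I * ξ))
    {φ θ : ℝ → ℂ} (hφ : Continuous φ) (hφc : HasCompactSupport φ) {κN : 𝓢(ℝ, ℂ)}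
    (hκN : ∀ ξ, fourierHat κN ξ = θ (ξ - N)) (t : ℝ) :
    avgIntegral t φ θ r N a = ((Real.exp (a * t) : ℝ) : ℂ) • ((2 * Real.pi : ℝ) : ℂ) •
      ∫ s : ℝ, (Complex.exp (-(a * s)) * φ s) • multOp m (tensor κN y) (t - s) := by
  set u := multOp m (tensor κN y) with hu
  set g : ℝ → ℂ := fun s => Complex.exp (-(a * s)) * φ s with hg
  have hκint := integrable_fourierHat_smul hm hmod κN y 0
  have hgi : Integrable g := integrable_bilap hφ hφc a
  have hprod : Integrable (fun z : ℝ × ℝ => (g z.1 * Complex.exp (Complex.I * z.2 * (t - z.1 : ℝ)) *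
      fourierHat κN z.2) • m z.2 y) (volume.prod volume) := by
    refine Integrable.mono' (hgi.norm.mul_prod hκint.norm) ?_ ?_
    · refine AEStronglyMeasurable.smul ?_
        ((hm y).aestronglyMeasurable.comp_snd)
      have := continuous_fourierHat κN
      exact Continuous.aestronglyMeasurable (by fun_prop)
    · refine Eventually.of_forall fun z => ?_
      have h1 : ‖Complex.exp (Complex.I * z.2 * (t - z.1 : ℝ))‖ = 1 := by
        rw [mul_assoc, mul_comm Complex.I, ← Complex.ofReal_mul, Complex.norm_exp_ofReal_mul_I]
      simp only [norm_smul, norm_mul, h1, Complex.ofReal_zero, mul_zero, Complex.exp_zero,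
        mul_one, one_mul]
      exact le_of_eq (by ring)
  have h1 : ∀ s, g s • u (t - s) = ((2 * Real.pi : ℝ) : ℂ)⁻¹ • ∫ ξ : ℝ,
      (g s * Complex.exp (Complex.I * ξ * (t - s : ℝ)) * fourierHat κN ξ) • m ξ y := by
    intro s
    rw [hu, multOp_tensor, smul_comm, ← integral_smul]
    simp_rw [smul_smul, mul_assoc]
  rw [integral_congr_ae (Eventually.of_forall h1), integral_smul, smul_smul ((2 * Real.pi : ℝ) : ℂ),
    mul_inv_cancel₀ (Complex.ofReal_ne_zero.2 (by positivity)), one_smul,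
    integral_integral_swap hprod, ← integral_smul, avgIntegral]
  refine integral_congr_ae (Eventually.of_forall fun ξ => ?_)
  simp only
  rw [integral_smul_const, smul_smul, hmr]
  congr 1
  rw [integral_mul_const, ← mul_assoc, hκN]
  congr 1
  rw [bilap, ← integral_const_mul, ← integral_const_mul]
  refine integral_congr_ae (Eventually.of_forall fun s => ?_)
  simp only [hg]
  rw [← mul_assoc, ← Complex.exp_add, mul_right_comm, mul_left_comm, ← mul_assoc,
    Complex.ofReal_exp, ← Complex.exp_add, ← Complex.exp_add]
  congr 2
  push_cast
  ring

/-- Uniformity in `N` comes from `‖κN s‖ = ‖κ s‖`: all the inputs have the same `L^p` norm. The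
compact support of `φ` and Hölder's inequality turn the `L^q` bound of the output into a pointwise
bound of the convolution. -/
theorem avgIntegral_bounded {p q : ℝ≥0∞} (hq : 1 ≤ q) {m : ℝ → ℝ → Y →L[ℂ] X} {y : Y} {r : ℂ → X}
    {a₁ a₂ C : ℝ} (ha₁ : 0 < a₁) (hC0 : 0 ≤ C) (hm : ∀ a ∈ Icc a₁ a₂, IsStronglyMeas (m a))
    (hmod : ∀ a ∈ Icc a₁ a₂, IsModerate (m a)) (hC : ∀ a ∈ Icc a₁ a₂, MultBound p q (m a) C)
    (hmr : ∀ a ∈ Icc a₁ a₂, ∀ ξ : ℝ, m a ξ y = r (a + Complex.I * ξ))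
    {φ θ : ℝ → ℂ} (hφ : Continuous φ) (hφc : HasCompactSupport φ)
    (hθ : ContDiff ℝ ∞ θ) (hθc : HasCompactSupport θ) (t : ℝ) :
    ∃ D : ℝ, ∀ a ∈ Icc a₁ a₂, ∀ N : ℝ, ‖avgIntegral t φ θ r N a‖ ≤ D := by
  obtain ⟨κ, hκ⟩ := exists_fourierHat_eq_translate hθ hθc
  obtain ⟨B, hB0, hB⟩ : ∃ B : ℝ, 0 ≤ B ∧ ∀ s, B < |s| → φ s = 0 := by
    obtain ⟨B, hB⟩ := hφc.isCompact.isBounded.exists_norm_le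
    refine ⟨max B 0, le_max_right _ _, fun s hs => ?_⟩
    by_contra h
    have := hB s (subset_tsupport _ h)
    rw [Real.norm_eq_abs] at this
    linarith [le_max_left B 0]
  obtain ⟨F, hF⟩ := hφ.bounded_above_of_compact_support hφc
  have hF0 : 0 ≤ F := (norm_nonneg _).trans (hF 0)
  obtain ⟨E, hE⟩ : ∃ E, E = ENNReal.ofReal C * eLpNorm (tensor κ y) p volume := ⟨_, rfl⟩
  have hEtop : E ≠ ⊤ := by
    rw [hE]
    exact ENNReal.mul_ne_top ENNReal.ofReal_ne_top (eLpNorm_tensor_ne_top κ y p)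
  obtain ⟨V, hV⟩ : ∃ V, V = (E * volume (Icc (-B) B) ^ (1 - 1 / q.toReal)).toReal := ⟨_, rfl⟩
  -- The first two factors bound the prefactor in `avgIntegral_eq`, `Real.exp (a₂ * B) * F` bounds
  -- the weight `e^{-as} φ(s)`, and `V` is the Hölder bound on `[-B, B]`.
  refine ⟨Real.exp (a₂ * |t|) * (2 * Real.pi) * (Real.exp (a₂ * B) * F * V), fun a ha N => ?_⟩
  have ha0 : 0 < a := ha₁.trans_le ha.1
  obtain ⟨κN, hκN, hnorm⟩ := hκ N
  have huE : eLpNorm (multOp (m a) (tensor κN y)) q volume ≤ E := by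
    have h := (hC a ha).eLpNorm_sum_tensor_le (hm a ha) (hmod a ha) hC0
      (fun _ : Unit => κN) (fun _ => y)
    simp only [Finset.univ_unique, Finset.sum_singleton] at h
    refine h.trans (le_of_eq ?_)
    rw [hE]
    congr 1
    refine eLpNorm_congr_norm_ae (Eventually.of_forall fun s => ?_)
    rw [tensor_apply, norm_smul, norm_smul, hnorm]
  set g : ℝ → ℂ := fun s => Complex.exp (-(a * s)) * φ s with hg
  have hgG : ∀ s, ‖g s‖ ≤ Real.exp (a₂ * B) * F := by
    intro s
    rcases lt_or_ge B |s| with hs | hs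
    · rw [hg]
      simp only [hB s hs, mul_zero, norm_zero]
      positivity
    · rw [hg, norm_mul, ← Complex.ofReal_mul, ← Complex.ofReal_neg, Complex.norm_exp_ofReal]
      gcongr
      · nlinarith [ha.2, (abs_le.1 hs).1]
      · exact hF s
  have hgB : ∀ s, B < |s| → g s = 0 := fun s hs => by rw [hg]; simp only [hB s hs, mul_zero]
  have hconv := norm_integral_smul_le (continuous_multOp_tensor (hm a ha) (hmod a ha) κN y) hq
    hEtop huE hgG hgB t
  rw [← hV] at hconv
  have hJ := avgIntegral_eq (hm a ha) (hmod a ha) (hmr a ha) hφ hφc hκN t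
  rw [hJ, norm_smul, norm_smul, Complex.norm_real, Complex.norm_real,
    Real.norm_of_nonneg (Real.exp_nonneg _),
    Real.norm_of_nonneg (by positivity : (0 : ℝ) ≤ 2 * Real.pi), ← mul_assoc]
  refine mul_le_mul (mul_le_mul_of_nonneg_right (Real.exp_le_exp.2 ?_) (by positivity)) hconv
    (norm_nonneg _) (by positivity)
  exact (mul_le_mul_of_nonneg_left (le_abs_self t) ha0.le).trans
    (mul_le_mul_of_nonneg_right ha.2 (abs_nonneg t))

/-- Write `a + iN = (a + iξ) - i(ξ - N)` under the integral. The first term replaces `φ` by its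
derivative, the second replaces the window `θ` by `iηθ(η)`. Both give averages bounded uniformly in
`N`, while the left side carries a factor of modulus at least `|N|`. -/
theorem avgIntegral_decay {p q : ℝ≥0∞} (hq : 1 ≤ q) {m : ℝ → ℝ → Y →L[ℂ] X} {y : Y} {r : ℂ → X}
    {a₁ a₂ C : ℝ} (ha₁ : 0 < a₁) (hC0 : 0 ≤ C) (hm : ∀ a ∈ Icc a₁ a₂, IsStronglyMeas (m a))
    (hmod : ∀ a ∈ Icc a₁ a₂, IsModerate (m a)) (hC : ∀ a ∈ Icc a₁ a₂, MultBound p q (m a) C)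
    (hmr : ∀ a ∈ Icc a₁ a₂, ∀ ξ : ℝ, m a ξ y = r (a + Complex.I * ξ))
    (hr : ContinuousOn r {z | 0 < z.re})
    {φ θ : ℝ → ℂ} (hφ : ContDiff ℝ ∞ φ) (hφc : HasCompactSupport φ)
    (hθ : ContDiff ℝ ∞ θ) (hθc : HasCompactSupport θ) (t : ℝ) :
    ∃ D : ℝ, ∀ a ∈ Icc a₁ a₂, ∀ N : ℝ, |N| * ‖avgIntegral t φ θ r N a‖ ≤ D := by
  have hφ' : Continuous (deriv φ) := hφ.continuous_deriv (by simp)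
  set θ₁ : ℝ → ℂ := fun η => (Complex.I * η) * θ η with hθ₁
  have hθ₁c : HasCompactSupport θ₁ := hθc.mul_left
  have hθ₁s : ContDiff ℝ ∞ θ₁ :=
    (contDiff_const.mul Complex.ofRealCLM.contDiff).mul hθ
  obtain ⟨D₁, hD₁⟩ := avgIntegral_bounded hq ha₁ hC0 hm hmod hC hmr hφ' hφc.deriv hθ hθc t
  obtain ⟨D₂, hD₂⟩ := avgIntegral_bounded hq ha₁ hC0 hm hmod hC hmr hφ.continuous hφc hθ₁s hθ₁c t
  refine ⟨D₁ + D₂, fun a ha N => ?_⟩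
  have ha0 : 0 < a := ha₁.trans_le ha.1
  have h1 : (a + Complex.I * N) • avgIntegral t φ θ r N a =
      avgIntegral t (deriv φ) θ r N a - avgIntegral t φ θ₁ r N a := by
    rw [avgIntegral, avgIntegral, avgIntegral, ← integral_smul, ← integral_sub
      (integrable_avgIntegral hφ' hφc.deriv hθ.continuous hθc hr t N ha0)
      (integrable_avgIntegral hφ.continuous hφc hθ₁s.continuous hθ₁c hr t N ha0)]
    refine integral_congr_ae (Eventually.of_forall fun ξ => ?_)
    simp only
    rw [smul_smul, ← sub_smul, bilap_deriv hφ hφc, hθ₁]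
    congr 1
    push_cast
    ring
  have h2 : |N| ≤ ‖(a + Complex.I * N : ℂ)‖ := by
    have := Complex.abs_im_le_norm (a + Complex.I * N : ℂ)
    simpa using this
  calc |N| * ‖avgIntegral t φ θ r N a‖ ≤ ‖(a + Complex.I * N : ℂ)‖ * ‖avgIntegral t φ θ r N a‖ := by
        gcongr
    _ = ‖avgIntegral t (deriv φ) θ r N a - avgIntegral t φ θ₁ r N a‖ := by rw [← norm_smul, h1]
    _ ≤ _ := (norm_sub_le _ _).trans (add_le_add (hD₁ a ha N) (hD₂ a ha N))

end Contour

end FourierMult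

/-! ### Shifting vertical contours with averaged control at infinity. -/

namespace FourierMult

open scoped ContDiff

variable {Y X : Type*} [NormedAddCommGroup Y] [NormedSpace ℂ Y]
  [NormedAddCommGroup X] [NormedSpace ℂ X]

/-- A function with a limit along `l` whose translated averages decay has limit zero. -/
theorem eq_zero_of_tendsto_of_average [CompleteSpace X] {H : ℝ → X} (hH : Continuous H) {L : X}
    {l : Filter ℝ} [l.NeBot] [l.IsCountablyGenerated] (hL : Tendsto H l (𝓝 L))
    (hl : ∀ P : ℝ → Prop, (∀ᶠ ρ in l, P ρ) → ∀ᶠ N in l, ∀ η : ℝ, |η| ≤ 2 → P (η + N))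
    (hl' : Tendsto (fun N : ℝ => |N|) l atTop) {θ : ℝ → ℝ} (hθ : Continuous θ)
    (hθ2 : ∀ η, 2 < |η| → θ η = 0) (hθi : ∫ η, θ η ≠ 0) {D : ℝ}
    (hD : ∀ N : ℝ, |N| * ‖∫ ρ : ℝ, (θ (ρ - N) : ℂ) • H ρ‖ ≤ D) : L = 0 := by
  have hc : HasCompactSupport θ := by
    refine HasCompactSupport.of_support_subset_isCompact (isCompact_Icc (a := -2) (b := 2)) ?_
    intro η hη
    by_contra h
    exact hη (hθ2 η (not_le.1 fun h' => h (abs_le.1 h')))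
  have hθint : Integrable θ := hθ.integrable_of_hasCompactSupport hc
  -- The hypothesis `hl` makes `l` stable under shifts by at most `2`, so the translated averages
  -- converge to the integral of `θ` times `L`; the decay in `N` forces this limit to vanish.
  have h1 : Tendsto (fun N : ℝ => ∫ ρ : ℝ, (θ (ρ - N) : ℂ) • H ρ) l
      (𝓝 (∫ η : ℝ, (θ η : ℂ) • L)) := by
    have h2 : ∀ N : ℝ, ∫ ρ : ℝ, (θ (ρ - N) : ℂ) • H ρ = ∫ η : ℝ, (θ η : ℂ) • H (η + N) := by
      intro N
      rw [← integral_add_right_eq_self _ N]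
      simp only [add_sub_cancel_right]
    simp_rw [h2]
    refine tendsto_integral_filter_of_dominated_convergence (fun η => |θ η| * (‖L‖ + 1))
      (Eventually.of_forall fun N => Continuous.aestronglyMeasurable (by fun_prop)) ?_
      (hθint.abs.mul_const _) (Eventually.of_forall fun η => ?_)
    · filter_upwards [hl (fun ρ => ‖H ρ‖ ≤ ‖L‖ + 1)
        (hL.norm.eventually_le_const (by linarith))] with N hN
      refine Eventually.of_forall fun η => ?_
      rw [norm_smul, Complex.norm_real, Real.norm_eq_abs]
      by_cases h : |η| ≤ 2
      · gcongr
        exact hN η h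
      · rw [hθ2 η (not_le.1 h), abs_zero, zero_mul, zero_mul]
    · by_cases h : |η| ≤ 2
      · refine Tendsto.const_smul ?_ _
        rw [tendsto_def] at hL ⊢
        intro s hs
        filter_upwards [hl (fun ρ => H ρ ∈ s) (hL s hs)] with N hN using hN η h
      · simp [hθ2 η (not_le.1 h)]
  have h3 : Tendsto (fun N : ℝ => ∫ ρ : ℝ, (θ (ρ - N) : ℂ) • H ρ) l (𝓝 0) := by
    rw [tendsto_zero_iff_norm_tendsto_zero]
    refine squeeze_zero' (Eventually.of_forall fun N => norm_nonneg _) ?_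
      (Tendsto.div_atTop tendsto_const_nhds hl' : Tendsto (fun N : ℝ => D / |N|) l (𝓝 0))
    filter_upwards [hl'.eventually_gt_atTop 0] with N hN
    rw [le_div_iff₀ hN, mul_comm]
    exact hD N
  have h4 := tendsto_nhds_unique h1 h3
  rw [integral_smul_const, integral_complex_ofReal] at h4
  exact (smul_eq_zero.1 h4).resolve_left (Complex.ofReal_ne_zero.2 hθi)

/-- Contour shift: vanishing averages of the horizontal integrals suffice. -/
theorem integral_vertical_eq [CompleteSpace X] {h : ℂ → X}
    (hh : DifferentiableOn ℂ h {z | 0 < z.re}) {a₁ a₂ : ℝ} (ha₁ : 0 < a₁) (h12 : a₁ ≤ a₂)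
    (hi₁ : Integrable fun ξ : ℝ => h (a₁ + Complex.I * ξ))
    (hi₂ : Integrable fun ξ : ℝ => h (a₂ + Complex.I * ξ)) {θ : ℝ → ℝ} (hθ : Continuous θ)
    (hθ2 : ∀ η, 2 < |η| → θ η = 0) (hθi : ∫ η, θ η ≠ 0) {D : ℝ}
    (hD : ∀ a ∈ Icc a₁ a₂, ∀ N : ℝ,
      |N| * ‖∫ ξ : ℝ, (θ (ξ - N) : ℂ) • h (a + Complex.I * ξ)‖ ≤ D) :
    ∫ ξ : ℝ, h (a₁ + Complex.I * ξ) = ∫ ξ : ℝ, h (a₂ + Complex.I * ξ) := by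
  set H : ℝ → X := fun ρ => ∫ a in a₁..a₂, h (a + Complex.I * ρ) with hHdef
  set d : ℝ → X := fun ξ => h (a₂ + Complex.I * ξ) - h (a₁ + Complex.I * ξ) with hd
  have hdi : Integrable d := hi₂.sub hi₁
  -- Cauchy's theorem on the rectangle between heights `0` and `ρ`. Since `d` is integrable, `H` has
  -- limits at both ends, and only their vanishing remains to be shown.
  have hH : ∀ ρ, H ρ = H 0 + Complex.I • ∫ ξ in (0 : ℝ)..ρ, d ξ := by
    intro ρ
    have hrect : DifferentiableOn ℂ h (uIcc (a₁ : ℂ).re (a₂ + Complex.I * ρ : ℂ).re ×ℂ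
        uIcc (a₁ : ℂ).im (a₂ + Complex.I * ρ : ℂ).im) := by
      refine hh.mono fun z hz => ?_
      have h1 := hz.1
      simp only [Complex.ofReal_re, Complex.add_re, Complex.mul_re, Complex.I_re, zero_mul,
        Complex.I_im, Complex.ofReal_im, mul_zero, sub_zero, add_zero, uIcc_of_le h12,
        mem_preimage] at h1
      exact ha₁.trans_le h1.1
    have hC := Complex.integral_boundary_rect_eq_zero_of_differentiableOn h _ _ hrect
    simp only [Complex.ofReal_re, Complex.add_re, Complex.mul_re, Complex.I_re, zero_mul,
      Complex.I_im, Complex.ofReal_im, mul_zero, sub_zero, add_zero, Complex.add_im,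
      Complex.mul_im, one_mul, zero_add, Complex.ofReal_zero] at hC
    have e : ∀ ξ : ℝ, (ξ : ℂ) * Complex.I = Complex.I * ξ := fun ξ => mul_comm _ _
    simp_rw [e] at hC
    have h0 : H 0 = ∫ x in a₁..a₂, h x := by
      rw [hHdef]
      simp only [Complex.ofReal_zero, mul_zero, add_zero]
    rw [hd, intervalIntegral.integral_sub hi₂.intervalIntegrable hi₁.intervalIntegrable,
      smul_sub, h0, hHdef]
    simp only
    rw [← sub_eq_zero, ← neg_eq_zero, ← hC]
    abel
  have hHc : Continuous H := by
    rw [funext hH]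
    exact continuous_const.add ((intervalIntegral.continuous_primitive
      (fun a b => hdi.intervalIntegrable) 0).const_smul _)
  have hswap : ∀ N : ℝ, ∫ ρ : ℝ, (θ (ρ - N) : ℂ) • H ρ =
      ∫ a in a₁..a₂, ∫ ρ : ℝ, (θ (ρ - N) : ℂ) • h (a + Complex.I * ρ) := by
    intro N
    simp_rw [hHdef, ← intervalIntegral.integral_smul]
    simp_rw [intervalIntegral.integral_of_le h12, ← integral_Icc_eq_integral_Ioc]
    refine integral_integral_swap
      (f := fun ρ a : ℝ => (θ (ρ - N) : ℂ) • h (a + Complex.I * ρ)) ?_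
    have hcont : ContinuousOn (Function.uncurry fun ρ a : ℝ =>
        (θ (ρ - N) : ℂ) • h (a + Complex.I * ρ)) (Icc (N - 2) (N + 2) ×ˢ Icc a₁ a₂) := by
      refine ContinuousOn.smul (Continuous.continuousOn (by fun_prop)) ?_
      refine hh.continuousOn.comp (Continuous.continuousOn (by fun_prop)) ?_
      rintro ⟨ρ, a⟩ ⟨-, ha⟩
      have : 0 < a := ha₁.trans_le ha.1
      simpa using this
    have hI := hcont.integrableOn_compact (μ := (volume : Measure ℝ).prod volume)
      (isCompact_Icc.prod isCompact_Icc)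
    have hI2 : IntegrableOn (Function.uncurry fun ρ a : ℝ =>
        (θ (ρ - N) : ℂ) • h (a + Complex.I * ρ)) (univ ×ˢ Icc a₁ a₂) (volume.prod volume) := by
      refine hI.of_forall_sdiff_eq_zero (MeasurableSet.univ.prod measurableSet_Icc) ?_
      rintro ⟨ρ, a⟩ ⟨⟨-, ha⟩, hn⟩
      have : 2 < |ρ - N| := by
        by_contra hle
        have h2 := abs_le.1 (not_lt.1 hle)
        exact hn ⟨⟨by linarith, by linarith⟩, ha⟩
      simp only [Function.uncurry_apply_pair, hθ2 _ this, Complex.ofReal_zero, zero_smul]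
    rw [IntegrableOn, ← Measure.prod_restrict, Measure.restrict_univ] at hI2
    exact hI2
  have hDH : ∀ N : ℝ, |N| * ‖∫ ρ : ℝ, (θ (ρ - N) : ℂ) • H ρ‖ ≤ D * (a₂ - a₁) := by
    intro N
    rw [hswap, ← abs_abs, ← Real.norm_eq_abs, ← norm_smul, ← intervalIntegral.integral_smul,
      ← abs_of_nonneg (sub_nonneg.2 h12)]
    refine intervalIntegral.norm_integral_le_of_norm_le_const fun a ha => ?_
    rw [uIoc_of_le h12] at ha
    rw [norm_smul, Real.norm_eq_abs, abs_abs]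
    exact hD a (Ioc_subset_Icc_self ha) N
  have hplus : H 0 + Complex.I • ∫ ξ in Ioi (0 : ℝ), d ξ = 0 := by
    refine eq_zero_of_tendsto_of_average (l := atTop) hHc ?_ ?_ tendsto_abs_atTop_atTop hθ hθ2 hθi hDH
    · refine Tendsto.congr (fun ρ => (hH ρ).symm) ?_
      exact tendsto_const_nhds.add ((intervalIntegral_tendsto_integral_Ioi 0 hdi.integrableOn
        tendsto_id).const_smul _)
    · intro P hP
      obtain ⟨ρ₀, hρ₀⟩ := eventually_atTop.1 hP
      filter_upwards [eventually_ge_atTop (ρ₀ + 2)] with N hN η hη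
      exact hρ₀ _ (by linarith [(abs_le.1 hη).1])
  have hminus : H 0 + Complex.I • -∫ ξ in Iic (0 : ℝ), d ξ = 0 := by
    refine eq_zero_of_tendsto_of_average (l := atBot) hHc ?_ ?_ tendsto_abs_atBot_atTop hθ hθ2 hθi hDH
    · refine Tendsto.congr (fun ρ => ((hH ρ).trans
        (by rw [intervalIntegral.integral_symm])).symm) ?_
      exact tendsto_const_nhds.add ((intervalIntegral_tendsto_integral_Iic 0 hdi.integrableOn
        tendsto_id).neg.const_smul _)
    · intro P hP
      obtain ⟨ρ₀, hρ₀⟩ := eventually_atBot.1 hP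
      filter_upwards [eventually_le_atBot (ρ₀ - 2)] with N hN η hη
      exact hρ₀ _ (by linarith [(abs_le.1 hη).2])
  -- Both limits of `H` are zero; subtracting the two formulas cancels `H 0`.
  have hzero : ∫ ξ, d ξ = 0 := by
    rw [← intervalIntegral.integral_Iic_add_Ioi hdi.integrableOn hdi.integrableOn (b := (0 : ℝ))]
    have h1 := hplus.trans hminus.symm
    rw [add_right_inj, smul_right_inj Complex.I_ne_zero] at h1
    rw [h1, add_neg_cancel]
  rw [hd, integral_sub hi₂ hi₁, sub_eq_zero] at hzero
  exact hzero.symm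

/-- For a family of uniformly bounded multipliers given by a holomorphic function on the right
half plane, the inverse Laplace integrals over vertical lines do not depend on the line. -/
theorem integral_bilap_eq [CompleteSpace Y] [CompleteSpace X] {p q : ℝ≥0∞} (hq : 1 ≤ q)
    {m : ℝ → ℝ → Y →L[ℂ] X} {y : Y} {r : ℂ → X}
    {a₁ a₂ C : ℝ} (ha₁ : 0 < a₁) (h12 : a₁ ≤ a₂) (hC0 : 0 ≤ C)
    (hm : ∀ a ∈ Icc a₁ a₂, IsStronglyMeas (m a))
    (hmod : ∀ a ∈ Icc a₁ a₂, IsModerate (m a)) (hC : ∀ a ∈ Icc a₁ a₂, MultBound p q (m a) C)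
    (hmr : ∀ a ∈ Icc a₁ a₂, ∀ ξ : ℝ, m a ξ y = r (a + Complex.I * ξ))
    (hr : DifferentiableOn ℂ r {z | 0 < z.re})
    {φ : ℝ → ℂ} (hφ : ContDiff ℝ ∞ φ) (hφc : HasCompactSupport φ) (t : ℝ)
    (hi : ∀ a ∈ Icc a₁ a₂, Integrable fun ξ : ℝ => (Complex.exp ((a + Complex.I * ξ) * t) *
      bilap φ (a + Complex.I * ξ)) • r (a + Complex.I * ξ)) :
    ∫ ξ : ℝ, (Complex.exp ((a₁ + Complex.I * ξ) * t) * bilap φ (a₁ + Complex.I * ξ)) •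
      r (a₁ + Complex.I * ξ) =
    ∫ ξ : ℝ, (Complex.exp ((a₂ + Complex.I * ξ) * t) * bilap φ (a₂ + Complex.I * ξ)) •
      r (a₂ + Complex.I * ξ) := by
  let f : ContDiffBump (0 : ℝ) := ⟨1, 2, one_pos, one_lt_two⟩
  have hθs : ContDiff ℝ ∞ fun η : ℝ => (f η : ℂ) := Complex.ofRealCLM.contDiff.comp f.contDiff
  have hθc : HasCompactSupport fun η : ℝ => (f η : ℂ) :=
    f.hasCompactSupport.comp_left (g := Complex.ofReal) Complex.ofReal_zero
  obtain ⟨D, hD⟩ := avgIntegral_decay hq ha₁ hC0 hm hmod hC hmr hr.continuousOn hφ hφc hθs hθc t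
  refine integral_vertical_eq
    (h := fun z => (Complex.exp (z * t) * bilap φ z) • r z) (θ := f) (D := D) ?_ ha₁ h12
    (hi a₁ (left_mem_Icc.2 h12)) (hi a₂ (right_mem_Icc.2 h12)) f.continuous ?_ ?_ ?_
  · refine DifferentiableOn.smul ?_ hr
    have := differentiable_bilap hφ.continuous hφc
    exact Differentiable.differentiableOn (by fun_prop)
  · intro η hη
    refine f.zero_of_le_dist ?_
    rw [Real.dist_eq, sub_zero]
    exact hη.le
  · exact f.integral_pos.ne'
  · intro a ha N
    refine le_trans (le_of_eq ?_) (hD a ha N)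
    rw [avgIntegral]
    simp_rw [smul_smul, mul_comm ((f _ : ℝ) : ℂ)]

end FourierMult

/-! ### From growth of the semigroup to multiplier bounds. -/

/-- The scale `x = a t` reduces this to a bound of `x^α e^{-x}`, which follows from `x/α ≤ e^{x/α}`;
undoing the scaling produces `a^{-α}`. -/
theorem Real.exists_rpow_mul_exp_neg_le {α : ℝ} (hα : 0 ≤ α) :
    ∃ D : ℝ, 0 ≤ D ∧ ∀ a : ℝ, 0 < a → ∀ t : ℝ, 0 ≤ t →
      Real.exp (-(a * t)) * (t ^ α + 1) ≤ D * (a ^ (-α) + 1) := by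
  have key : ∀ x : ℝ, 0 ≤ x → x ^ α ≤ α ^ α * Real.exp x := by
    intro x hx
    -- For `α = 0` the constant `α ^ α` is `1`.
    rcases hα.eq_or_lt with rfl | hα
    · simpa using hx
    · have h1 : (x / α) ^ α ≤ Real.exp (x / α) ^ α :=
        Real.rpow_le_rpow (by positivity) (by linarith [Real.add_one_le_exp (x / α)]) hα.le
      rw [← Real.exp_mul, div_mul_cancel₀ _ hα.ne', Real.div_rpow hx hα.le,
        div_le_iff₀ (by positivity), mul_comm] at h1
      exact h1
  have hD : 0 ≤ α ^ α := Real.rpow_nonneg hα α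
  refine ⟨α ^ α + 1, by positivity, fun a ha t ht => ?_⟩
  have h1 := key (a * t) (by positivity)
  have ha' : 0 < a ^ (-α) := Real.rpow_pos_of_pos ha _
  have h2 : Real.exp (-(a * t)) * t ^ α ≤ α ^ α * a ^ (-α) := by
    have h3 : t ^ α = a ^ (-α) * (a * t) ^ α := by
      rw [Real.mul_rpow ha.le ht, ← mul_assoc, ← Real.rpow_add ha, neg_add_cancel, Real.rpow_zero,
        one_mul]
    calc Real.exp (-(a * t)) * t ^ α
        ≤ Real.exp (-(a * t)) * (a ^ (-α) * (α ^ α * Real.exp (a * t))) := by rw [h3]; gcongr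
      _ = α ^ α * a ^ (-α) * (Real.exp (-(a * t)) * Real.exp (a * t)) := by ring
      _ = _ := by rw [← Real.exp_add, neg_add_cancel, Real.exp_zero, mul_one]
  have h4 : Real.exp (-(a * t)) ≤ 1 := Real.exp_le_one_iff.2 (by nlinarith)
  nlinarith

namespace C0Semigroup

open FourierMult

variable {Y X : Type*} [NormedAddCommGroup Y] [NormedSpace ℂ Y]
  [NormedAddCommGroup X] [NormedSpace ℂ X]

/-- The causal kernel `e^{-as} T(s) J`, `s > 0`. -/
noncomputable def causalKernel (T : C0Semigroup X) (J : Y →L[ℂ] X) (a : ℝ) : ℝ → Y →L[ℂ] X :=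
  (Ioi 0).indicator fun s => Complex.exp (-(a * s)) • (T s ∘L J)

theorem causalKernel_apply (T : C0Semigroup X) (J : Y →L[ℂ] X) (a : ℝ) (y : Y) (s : ℝ) :
    T.causalKernel J a s y =
      (Ioi 0).indicator (fun s : ℝ => Complex.exp (-(a * s)) • T s (J y)) s := by
  by_cases hs : s ∈ Ioi (0 : ℝ)
  · simp [causalKernel, indicator_of_mem hs]
  · simp [causalKernel, indicator_of_notMem hs]

theorem aestronglyMeasurable_causalKernel (T : C0Semigroup X) {w M : ℝ}
    (hM : ∀ t : ℝ, 0 ≤ t → ‖T t‖ ≤ M * Real.exp (w * t)) (J : Y →L[ℂ] X) (a : ℝ)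
    {g : ℝ → Y} (hg : Continuous g) :
    AEStronglyMeasurable (fun z : ℝ × ℝ => T.causalKernel J a z.1 (g z.2))
      (volume.prod volume) := by
  have h1 : (fun z : ℝ × ℝ => T.causalKernel J a z.1 (g z.2)) = (Ioi 0 ×ˢ univ).indicator
      fun z : ℝ × ℝ => Complex.exp (-(a * z.1)) • T z.1 (J (g z.2)) := by
    ext z
    rw [causalKernel_apply]
    by_cases hz : z.1 ∈ Ioi (0 : ℝ)
    · rw [indicator_of_mem hz, indicator_of_mem (show z ∈ Ioi (0 : ℝ) ×ˢ univ from ⟨hz, trivial⟩)]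
    · rw [indicator_of_notMem hz, indicator_of_notMem fun h => hz h.1]
  rw [h1, aestronglyMeasurable_indicator_iff (measurableSet_Ioi.prod MeasurableSet.univ)]
  refine ContinuousOn.aestronglyMeasurable ?_ (measurableSet_Ioi.prod MeasurableSet.univ)
  refine ContinuousOn.smul (Continuous.continuousOn (by fun_prop)) ?_
  refine (T.continuousOn_apply hM).comp (f := fun z : ℝ × ℝ => (z.1, J (g z.2)))
    (Continuous.continuousOn (by fun_prop)) ?_
  rintro z ⟨hz, -⟩
  exact ⟨Ioi_subset_Ici_self hz, trivial⟩

theorem integrable_causalKernel_apply (T : C0Semigroup X) {J : Y →L[ℂ] X} {a : ℝ} {k : ℝ → ℝ}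
    (hk : Integrable k) (hK : ∀ s, ‖T.causalKernel J a s‖ ≤ k s) (y : Y) :
    Integrable fun s => T.causalKernel J a s y := by
  refine (hk.mul_const ‖y‖).mono' ?_ (Eventually.of_forall fun s =>
    ((T.causalKernel J a s).le_opNorm y).trans (by gcongr; exact hK s))
  rw [funext (T.causalKernel_apply J a y), aestronglyMeasurable_indicator_iff measurableSet_Ioi]
  refine ContinuousOn.aestronglyMeasurable ?_ measurableSet_Ioi
  exact ContinuousOn.smul (Continuous.continuousOn (by fun_prop))
    ((T.continuousOn_orbit _).mono Ioi_subset_Ici_self)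

theorem resolvent_comp_apply [CompleteSpace X] (T : C0Semigroup X) {B : X →ₗ.[ℂ] X}
    (hB : T.IsGenerator B) {J : Y →L[ℂ] X} {a : ℝ} {ξ : ℝ}
    (hz : (a + Complex.I * ξ : ℂ) ∈ B.resolventSet) {y : Y}
    (hint : Integrable fun s => T.causalKernel J a s y) :
    B.resolvent (a + Complex.I * ξ) (J y) = fourierHat (fun s => T.causalKernel J a s y) ξ := by
  have h1 : ∀ s : ℝ, Complex.exp (-(Complex.I * ξ * s)) • T.causalKernel J a s y =
      (Ioi 0).indicator (fun s : ℝ => Complex.exp (-((a + Complex.I * ξ) * s)) • T s (J y)) s := by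
    intro s
    rw [causalKernel_apply]
    by_cases hs : s ∈ Ioi (0 : ℝ)
    · rw [indicator_of_mem hs, indicator_of_mem hs, smul_smul, ← Complex.exp_add]
      congr 2
      ring
    · rw [indicator_of_notMem hs, indicator_of_notMem hs, smul_zero]
  have h2 : Integrable fun s : ℝ => Complex.exp (-(Complex.I * ξ * s)) • T.causalKernel J a s y := by
    refine hint.norm.mono' ?_ (Eventually.of_forall fun s => ?_)
    · exact (Continuous.aestronglyMeasurable (by fun_prop)).smul hint.aestronglyMeasurable
    · rw [norm_smul, mul_assoc, mul_comm Complex.I, ← neg_mul, ← Complex.ofReal_mul,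
        ← Complex.ofReal_neg, Complex.norm_exp_ofReal_mul_I, one_mul]
  simp_rw [h1] at h2
  rw [T.resolvent_eq_integral hB hz ((integrable_indicator_iff measurableSet_Ioi).1 h2), fourierHat,
    integral_congr_ae (Eventually.of_forall h1), integral_indicator measurableSet_Ioi]

theorem isStronglyMeas_resolvent {B : X →ₗ.[ℂ] X} (hρ : {z : ℂ | 0 < z.re} ⊆ B.resolventSet)
    (J : Y →L[ℂ] X) {a : ℝ} (ha : 0 < a) :
    IsStronglyMeas fun ξ : ℝ => B.resolvent ((a : ℂ) + Complex.I * ξ) ∘L J := by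
  intro y
  refine Continuous.stronglyMeasurable ?_
  refine (LinearPMap.continuousOn_resolvent hρ (J y)).comp_continuous
    (f := fun ξ : ℝ => (a : ℂ) + Complex.I * ξ) (by fun_prop) fun ξ => by simpa using ha

/-- The kernel serves twice: its supremum gives the bound from `L^1` to `L^∞`, and an integrable
majorant identifies the resolvent with its Fourier transform and justifies the convolution formula.
-/
theorem exists_mult_of_growth [CompleteSpace Y] [CompleteSpace X] (T : C0Semigroup X)
    {B : X →ₗ.[ℂ] X} (hB : T.IsGenerator B) (hρ : {z : ℂ | 0 < z.re} ⊆ B.resolventSet)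
    {w M : ℝ} (hM : ∀ t : ℝ, 0 ≤ t → ‖T t‖ ≤ M * Real.exp (w * t)) (J : Y →L[ℂ] X)
    {α : ℝ} (hα : 0 ≤ α) {C : ℝ} (hC0 : 0 ≤ C)
    (hC : ∀ t : ℝ, 0 ≤ t → ‖T t ∘L J‖ ≤ C * (t ^ α + 1)) :
    ∃ C' : ℝ, 0 ≤ C' ∧ ∀ a : ℝ, 0 < a →
      (fun ξ : ℝ => B.resolvent ((a : ℂ) + Complex.I * ξ) ∘L J) ∈ Mult 1 ⊤ ∧
      multNorm 1 ⊤ (fun ξ : ℝ => B.resolvent ((a : ℂ) + Complex.I * ξ) ∘L J) ≤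
        C' * (a ^ (-α) + 1) := by
  obtain ⟨D, hD0, hD⟩ := Real.exists_rpow_mul_exp_neg_le hα
  refine ⟨C * D, by positivity, fun a ha => ?_⟩
  set m := fun ξ : ℝ => B.resolvent ((a : ℂ) + Complex.I * ξ) ∘L J with hm
  have hbound : ∀ s, ‖T.causalKernel J a s‖ ≤ C * D * (a ^ (-α) + 1) := by
    intro s
    have := Real.rpow_nonneg ha.le (-α)
    by_cases hs : s ∈ Ioi (0 : ℝ)
    · rw [causalKernel, indicator_of_mem hs, norm_smul, ← Complex.ofReal_mul, ← Complex.ofReal_neg,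
        Complex.norm_exp_ofReal]
      calc _ ≤ Real.exp (-(a * s)) * (C * (s ^ α + 1)) := by gcongr; exact hC s (le_of_lt hs)
        _ = C * (Real.exp (-(a * s)) * (s ^ α + 1)) := by ring
        _ ≤ C * (D * (a ^ (-α) + 1)) := mul_le_mul_of_nonneg_left (hD a ha s (le_of_lt hs)) hC0
        _ = _ := by ring
    · rw [causalKernel, indicator_of_notMem hs, norm_zero]
      positivity
  -- Half of the exponential decay absorbs the polynomial growth, and the other half makes the
  -- majorant integrable.
  set k : ℝ → ℝ := (Ioi 0).indicator
    fun s => C * (D * ((a / 2) ^ (-α) + 1)) * Real.exp (-(a / 2) * s) with hkdef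
  have hk : Integrable k := by
    rw [hkdef, integrable_indicator_iff measurableSet_Ioi]
    exact (integrableOn_exp_mul_Ioi (by linarith : -(a / 2) < 0) 0).const_mul _
  have hK : ∀ s, ‖T.causalKernel J a s‖ ≤ k s := by
    intro s
    by_cases hs : s ∈ Ioi (0 : ℝ)
    · rw [causalKernel, hkdef, indicator_of_mem hs, indicator_of_mem hs, norm_smul,
        ← Complex.ofReal_mul, ← Complex.ofReal_neg, Complex.norm_exp_ofReal]
      have h1 := hD (a / 2) (by linarith) s (le_of_lt hs)
      calc _ ≤ Real.exp (-(a * s)) * (C * (s ^ α + 1)) := by gcongr; exact hC s (le_of_lt hs)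
        _ = C * (Real.exp (-(a / 2 * s)) * (s ^ α + 1)) * Real.exp (-(a / 2) * s) := by
            rw [show -(a * s) = -(a / 2 * s) + -(a / 2) * s by ring, Real.exp_add]
            ring
        _ ≤ _ := by gcongr
    · rw [causalKernel, hkdef, indicator_of_notMem hs, indicator_of_notMem hs, norm_zero]
  have hmK : ∀ ξ y, m ξ y = fourierHat (fun s => T.causalKernel J a s y) ξ := fun ξ y =>
    T.resolvent_comp_apply hB (hρ (by simpa using ha))
      (T.integrable_causalKernel_apply hk hK y)
  have hmod : IsModerate m := by
    -- The multiplier is bounded by `∫ k`, so any weight exponent above `1` gives moderate growth.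
    refine ⟨2, two_pos, fun ξ => (∫ s, k s) * (1 + ‖ξ‖) ^ (-2 : ℝ),
      (integrable_one_add_norm (by simp)).const_mul _, fun ξ => ?_⟩
    simp only [Real.norm_eq_abs]
    rw [mul_comm]
    gcongr
    refine ContinuousLinearMap.opNorm_le_bound _
      (integral_nonneg fun s => (norm_nonneg _).trans (hK s)) fun y => ?_
    rw [hmK, fourierHat, ← integral_mul_const]
    refine norm_integral_le_of_norm_le (hk.mul_const _) (Eventually.of_forall fun s => ?_)
    rw [norm_smul, mul_assoc, mul_comm Complex.I, ← neg_mul, ← Complex.ofReal_mul,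
        ← Complex.ofReal_neg, Complex.norm_exp_ofReal_mul_I, one_mul]
    exact ((T.causalKernel J a s).le_opNorm y).trans (by gcongr; exact hK s)
  have hMB : MultBound 1 ⊤ m (C * D * (a ^ (-α) + 1)) := by
    refine Or.inl ⟨ENNReal.one_ne_top, fun f => ?_⟩
    have hb0 : 0 ≤ C * D * (a ^ (-α) + 1) := (norm_nonneg _).trans (hbound 0)
    refine eLpNormEssSup_le_of_ae_enorm_bound (Eventually.of_forall fun t => ?_)
    rw [multOp_eq_convolution hk hK
      (fun g hg => T.aestronglyMeasurable_causalKernel hM J a hg) hmK f t]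
    have hfi : Integrable fun s => f (t - s) := f.integrable.comp_sub_left t
    rw [eLpNorm_one_eq_lintegral_enorm, ← ofReal_integral_norm_eq_lintegral_enorm f.integrable,
      ← ENNReal.ofReal_mul hb0, ← ofReal_norm]
    refine ENNReal.ofReal_le_ofReal ?_
    rw [← integral_sub_left_eq_self (fun s => ‖f s‖) volume t, ← integral_const_mul]
    refine norm_integral_le_of_norm_le (hfi.norm.const_mul _) (Eventually.of_forall fun s => ?_)
    exact ((T.causalKernel J a s).le_opNorm _).trans (by gcongr; exact hbound s)
  have hb0 : 0 ≤ C * D * (a ^ (-α) + 1) := (norm_nonneg _).trans (hbound 0)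
  exact ⟨⟨isStronglyMeas_resolvent hρ J ha, hmod, _, hb0, hMB⟩,
    csInf_le ⟨0, fun c hc => hc.1⟩ ⟨hb0, hMB⟩⟩

end C0Semigroup

/-! ### Extracting bounds from the multiplier norm. -/

namespace FourierMult

variable {Y X : Type*} [NormedAddCommGroup Y] [NormedSpace ℂ Y]
  [NormedAddCommGroup X] [NormedSpace ℂ X]

theorem MultBound.mono {p q : ℝ≥0∞} {m : ℝ → Y →L[ℂ] X} {C C' : ℝ} (h : MultBound p q m C)
    (hC : C ≤ C') : MultBound p q m C' := by
  rcases h with ⟨hp, h⟩ | ⟨hp, hq, K, hK, h⟩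
  · exact Or.inl ⟨hp, fun f => (h f).trans (by gcongr)⟩
  · exact Or.inr ⟨hp, hq, K, hK, fun f => (h f).trans (by gcongr)⟩

theorem multBound_of_multNorm_lt {p q : ℝ≥0∞} {m : ℝ → Y →L[ℂ] X} {C : ℝ} (hm : m ∈ Mult p q)
    (hC : multNorm p q m < C) : MultBound p q m C := by
  obtain ⟨c, ⟨-, hc⟩, hlt⟩ := exists_lt_of_csInf_lt hm.2.2 hC
  exact hc.mono hlt.le

end FourierMult

/-! ### The convolution formula at every abscissa `a > 0`. -/

namespace C0Semigroup

open FourierMult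
open scoped ContDiff

/-- The Schwartz function `s ↦ e^{-as} φ(s)`. -/
noncomputable def expWeight {φ : ℝ → ℂ} (hφ : ContDiff ℝ ∞ φ) (hc : HasCompactSupport φ) (a : ℝ) :
    𝓢(ℝ, ℂ) :=
  HasCompactSupport.toSchwartzMap (f := fun s : ℝ => Complex.exp (-(a * s)) * φ s) hc.mul_left
    ((Complex.contDiff_exp.comp (contDiff_const.mul Complex.ofRealCLM.contDiff).neg).mul hφ)

theorem expWeight_apply {φ : ℝ → ℂ} (hφ : ContDiff ℝ ∞ φ) (hc : HasCompactSupport φ) (a s : ℝ) :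
    expWeight hφ hc a s = Complex.exp (-(a * s)) * φ s := rfl

theorem fourierHat_expWeight {φ : ℝ → ℂ} (hφ : ContDiff ℝ ∞ φ) (hc : HasCompactSupport φ)
    (a ξ : ℝ) : fourierHat (expWeight hφ hc a) ξ = bilap φ (a + Complex.I * ξ) := by
  rw [fourierHat, bilap]
  refine integral_congr_ae (Eventually.of_forall fun s => ?_)
  simp only [expWeight_apply, smul_eq_mul]
  rw [← mul_assoc, ← Complex.exp_add]
  congr 2
  ring

variable {Y X : Type*} [NormedAddCommGroup Y] [NormedSpace ℂ Y]
  [NormedAddCommGroup X] [NormedSpace ℂ X]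

theorem integrable_causalKernel_of_lt (T : C0Semigroup X) {w M : ℝ}
    (hM : ∀ t : ℝ, 0 ≤ t → ‖T t‖ ≤ M * Real.exp (w * t)) (J : Y →L[ℂ] X) {a : ℝ} (ha : w < a)
    (y : Y) : Integrable fun s => T.causalKernel J a s y := by
  refine T.integrable_causalKernel_apply (k := (Ioi 0).indicator fun s =>
    M * ‖J‖ * Real.exp ((w - a) * s)) ?_ (fun s => ?_) y
  · rw [integrable_indicator_iff measurableSet_Ioi]
    exact (integrableOn_exp_mul_Ioi (by linarith) 0).const_mul _
  · by_cases hs : s ∈ Ioi (0 : ℝ)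
    · rw [causalKernel, indicator_of_mem hs, indicator_of_mem hs, norm_smul,
        ← Complex.ofReal_mul, ← Complex.ofReal_neg, Complex.norm_exp_ofReal]
      calc _ ≤ Real.exp (-(a * s)) * (M * Real.exp (w * s) * ‖J‖) := by
            gcongr
            exact (ContinuousLinearMap.opNorm_comp_le _ _).trans
              (mul_le_mul_of_nonneg_right (hM s (le_of_lt hs)) (norm_nonneg _))
        _ = _ := by
            rw [show (w - a) * s = -(a * s) + w * s by ring, Real.exp_add]
            ring
    · rw [causalKernel, indicator_of_notMem hs, indicator_of_notMem hs, norm_zero]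

/-- If the resolvent restricted to `Y` is a locally uniformly bounded family of multipliers, then
the multiplier operators act on test functions as convolution with the semigroup, even when the
Laplace transform of the semigroup does not converge. -/
theorem multOp_resolvent_tensor [CompleteSpace Y] [CompleteSpace X] (T : C0Semigroup X)
    {B : X →ₗ.[ℂ] X} (hB : T.IsGenerator B) (hρ : {z : ℂ | 0 < z.re} ⊆ B.resolventSet)
    {w M : ℝ} (hM : ∀ t : ℝ, 0 ≤ t → ‖T t‖ ≤ M * Real.exp (w * t)) (J : Y →L[ℂ] X)
    {p q : ℝ≥0∞} (hq : 1 ≤ q) {Ω : ℝ → ℝ} (hΩ : AntitoneOn Ω (Ioi 0)) (hΩ0 : ∀ a, 0 < a → 0 ≤ Ω a)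
    (hmod : ∀ a : ℝ, 0 < a →
      IsModerate (fun ξ : ℝ => B.resolvent ((a : ℂ) + Complex.I * ξ) ∘L J))
    (hbd : ∀ a : ℝ, 0 < a →
      MultBound p q (fun ξ : ℝ => B.resolvent ((a : ℂ) + Complex.I * ξ) ∘L J) (Ω a))
    {φ : ℝ → ℂ} (hφ : ContDiff ℝ ∞ φ) (hc : HasCompactSupport φ) (y : Y) {a : ℝ} (ha : 0 < a)
    (t : ℝ) :
    multOp (fun ξ : ℝ => B.resolvent ((a : ℂ) + Complex.I * ξ) ∘L J)
        (tensor (expWeight hφ hc a) y) t =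
      Complex.exp (-(a * t)) • ∫ s in Ioi (0 : ℝ), φ (t - s) • T s (J y) := by
  set m : ℝ → ℝ → Y →L[ℂ] X := fun a ξ => B.resolvent ((a : ℂ) + Complex.I * ξ) ∘L J with hm
  have hsm : ∀ b, 0 < b → IsStronglyMeas (m b) := fun b hb => isStronglyMeas_resolvent hρ J hb
  have hker : ∀ b ξ : ℝ, (Complex.exp ((b + Complex.I * ξ) * t) * bilap φ (b + Complex.I * ξ)) •
      B.resolvent (b + Complex.I * ξ) (J y) = Complex.exp (b * t) •
        ((Complex.exp (Complex.I * ξ * t) * fourierHat (expWeight hφ hc b) ξ) • m b ξ y) := by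
    intro b ξ
    rw [fourierHat_expWeight, smul_smul, add_mul, Complex.exp_add, mul_assoc]
    rfl
  have hG : ∀ b : ℝ, multOp (m b) (tensor (expWeight hφ hc b) y) t =
      ((2 * Real.pi : ℝ) : ℂ)⁻¹ • Complex.exp (-(b * t)) • ∫ ξ : ℝ,
        (Complex.exp ((b + Complex.I * ξ) * t) * bilap φ (b + Complex.I * ξ)) •
          B.resolvent (b + Complex.I * ξ) (J y) := by
    intro b
    simp_rw [hker]
    rw [integral_smul, smul_smul (Complex.exp _), ← Complex.exp_add, neg_add_cancel,
      Complex.exp_zero, one_smul, multOp_tensor]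
  -- At the abscissa `b > w` the Laplace integral converges absolutely and the convolution formula
  -- is classical; the contour is shifted from there to `a`.
  set b := max a (w + 1) with hb
  have hab : a ≤ b := le_max_left _ _
  have hwb : w < b := (lt_add_one w).trans_le (le_max_right _ _)
  have hpos : ∀ c ∈ Icc a b, 0 < c := fun c hc => ha.trans_le hc.1
  -- Since `Ω` is antitone, `Ω a` is a common multiplier bound for all abscissae in `[a, b]`.
  have hshift := integral_bilap_eq hq (m := m) (y := y) (r := fun z => B.resolvent z (J y))
    ha hab (hΩ0 a ha) (fun c hc => hsm c (hpos c hc)) (fun c hc => hmod c (hpos c hc))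
    (fun c hc => (hbd c (hpos c hc)).mono (hΩ ha (hpos c hc) hc.1)) (fun _ _ _ => rfl)
    (LinearPMap.differentiableOn_resolvent hρ (J y)) hφ hc t
    (fun c hc' => by
      simp_rw [hker]
      exact (integrable_fourierHat_smul (hsm c (hpos c hc')) (hmod c (hpos c hc')) _ y t).smul _)
  have hconv : multOp (m b) (tensor (expWeight hφ hc b) y) t =
      Complex.exp (-(b * t)) • ∫ s in Ioi (0 : ℝ), φ (t - s) • T s (J y) := by
    have hKi := T.integrable_causalKernel_of_lt hM J hwb y
    have hmK : ∀ ξ, m b ξ y = fourierHat (fun s => T.causalKernel J b s y) ξ := fun ξ =>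
      T.resolvent_comp_apply hB (hρ (by simpa using ha.trans_le hab)) hKi
    rw [multOp_tensor_eq_convolution hKi hmK, ← integral_smul, ← integral_indicator
        measurableSet_Ioi]
    refine integral_congr_ae (Eventually.of_forall fun s => ?_)
    simp only [causalKernel_apply]
    by_cases hs : s ∈ Ioi (0 : ℝ)
    · rw [indicator_of_mem hs, indicator_of_mem hs, expWeight_apply, smul_smul, smul_smul,
        mul_right_comm, ← Complex.exp_add]
      congr 3
      push_cast
      ring
    · rw [indicator_of_notMem hs, indicator_of_notMem hs, smul_zero]
  have h1 := hG b
  rw [hconv, ← hshift, smul_comm] at h1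
  rw [smul_right_inj (Complex.exp_ne_zero _)] at h1
  change multOp (m a) _ t = _
  rw [hG a, h1, smul_comm]

/-- Bernstein polynomials have scalar polynomial coefficients and values of `g` as vectors, so after
multiplication by a test function they are finite sums of elementary tensors. -/
theorem exists_contDiff_approx (g : C(unitInterval, Y)) {ε : ℝ} (hε : 0 < ε) :
    ∃ (n : ℕ) (b : Fin n → ℝ → ℝ) (y : Fin n → Y), (∀ k, ContDiff ℝ ∞ (b k)) ∧
      ∀ s : unitInterval, ‖∑ k, b k s • y k - g s‖ ≤ ε := by
  have h := bernsteinApproximation_uniform g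
  rw [ContinuousMap.tendsto_iff_tendstoUniformly, Metric.tendstoUniformly_iff] at h
  obtain ⟨n, hn⟩ := (h ε hε).exists
  refine ⟨n + 1, fun k s => n.choose k * s ^ (k : ℕ) * (1 - s) ^ (n - k), fun k => g (bernstein.z k),
    fun k => by fun_prop, fun s => ?_⟩
  have h1 := (hn s).le
  rw [dist_comm, dist_eq_norm, bernsteinApproximation.apply] at h1
  simpa only [bernstein_apply] using h1

/-- A smooth probability density supported in the unit interval. -/
theorem exists_unit_density : ∃ φ : ℝ → ℝ, ContDiff ℝ ∞ φ ∧ HasCompactSupport φ ∧ (∀ s, 0 ≤ φ s) ∧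
    (∀ s, s ∉ Icc (0 : ℝ) 1 → φ s = 0) ∧ ∫ s, φ s = 1 := by
  let f : ContDiffBump (1 / 2 : ℝ) := ⟨1 / 4, 1 / 2, by norm_num, by norm_num⟩
  refine ⟨f.normed volume, f.contDiff_normed, f.hasCompactSupport_normed,
    fun s => f.nonneg_normed s, fun s hs => ?_, f.integral_normed⟩
  by_contra h
  have h1 : s ∈ Function.support (f.normed volume) := h
  rw [f.support_normed_eq, Metric.mem_ball, Real.dist_eq] at h1
  have h2 := abs_lt.1 h1
  simp only [f] at h2
  exact hs ⟨by linarith, by linarith⟩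

end C0Semigroup

/-! ### From multiplier bounds to growth of the semigroup. -/

namespace C0Semigroup

open FourierMult
open scoped ContDiff

variable {Y X : Type*} [NormedAddCommGroup Y] [NormedSpace ℂ Y]
  [NormedAddCommGroup X] [NormedSpace ℂ X]

theorem integral_Ioi_smul_orbit (T : C0Semigroup X) {ψ : ℝ → ℂ}
    (hψ : ∀ s, s ∉ Icc (0 : ℝ) 1 → ψ s = 0) (x : X) {τ : ℝ} (hτ : 1 < τ) :
    ∫ s in Ioi (0 : ℝ), ψ (τ - s) • T s x = ∫ s in Icc (0 : ℝ) 1, ψ s • T (τ - s) x := by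
  rw [← integral_indicator measurableSet_Ioi, ← integral_indicator measurableSet_Icc,
    ← integral_sub_left_eq_self _ volume τ]
  refine integral_congr_ae (Eventually.of_forall fun s => ?_)
  by_cases hs : s ∈ Icc (0 : ℝ) 1
  · have h1 : τ - s ∈ Ioi (0 : ℝ) := show 0 < τ - s by linarith [hs.2]
    simp only [indicator_of_mem hs, indicator_of_mem h1, sub_sub_cancel]
  · by_cases h1 : τ - s ∈ Ioi (0 : ℝ)
    · simp only [indicator_of_notMem hs, indicator_of_mem h1, sub_sub_cancel, hψ s hs, zero_smul]
    · simp only [indicator_of_notMem hs, indicator_of_notMem h1]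

/-- The convolution of the semigroup with a weighted approximate orbit approximates the orbit. -/
theorem norm_orbit_sub_le [CompleteSpace X] (T : C0Semigroup X) {w M : ℝ} (hM0 : 0 ≤ M)
    (hM : ∀ t : ℝ, 0 ≤ t → ‖T t‖ ≤ M * Real.exp (w * t)) (J : Y →L[ℂ] X)
    {φ : ℝ → ℝ} (hφc : Continuous φ) (hφ0 : ∀ s, 0 ≤ φ s)
    (hφs : ∀ s, s ∉ Icc (0 : ℝ) 1 → φ s = 0) (hφi : ∫ s, φ s = 1)
    {x : X} {g : C(unitInterval, Y)} (hg : ∀ s : unitInterval, J (g s) = T s x)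
    {n : ℕ} {b : Fin n → ℝ → ℝ} {y : Fin n → Y} (hb : ∀ k, Continuous (b k)) {ε : ℝ}
    (happ : ∀ s : unitInterval, ‖∑ k, b k s • y k - g s‖ ≤ ε) {τ : ℝ} (hτ : 1 < τ) :
    ‖(∑ k, ∫ s in Ioi (0 : ℝ), ((φ (τ - s) * b k (τ - s) : ℝ) : ℂ) • T s (J (y k))) - T τ x‖ ≤
      M * Real.exp (|w| * τ) * (‖J‖ * ε) := by
  have horb : ∀ z : X, ContinuousOn (fun s => T (τ - s) z) (Icc 0 1) := fun z =>
    (T.continuousOn_orbit z).comp (Continuous.continuousOn (by fun_prop))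
      fun s hs => sub_nonneg.2 (hs.2.trans hτ.le)
  have hint : ∀ k, IntegrableOn (fun s => ((φ s * b k s : ℝ) : ℂ) • T (τ - s) (J (y k)))
      (Icc 0 1) := fun k => by
    have := hb k
    exact (ContinuousOn.smul (Continuous.continuousOn (by fun_prop)) (horb _)).integrableOn_Icc
  have hφint : IntegrableOn φ (Icc 0 1) := hφc.continuousOn.integrableOn_Icc
  have hφI : ∫ s in Icc (0 : ℝ) 1, φ s = 1 := by
    rw [setIntegral_eq_integral_of_forall_compl_eq_zero hφs, hφi]
  -- As `φ` has integral one, `T τ x` is the average of the constant `T (τ - s) (T s x)`; the error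
  -- is then an average of `T (τ - s) J` applied to the approximation error in `Y`.
  have h1 : T τ x = ∫ s in Icc (0 : ℝ) 1, (φ s : ℂ) • T τ x := by
    rw [integral_smul_const, integral_complex_ofReal, hφI, Complex.ofReal_one, one_smul]
  have hcint : IntegrableOn (fun s => (φ s : ℂ) • T τ x) (Icc 0 1) :=
    Continuous.integrableOn_Icc (by fun_prop)
  have h2 : ∀ k, ∫ s in Ioi (0 : ℝ), ((φ (τ - s) * b k (τ - s) : ℝ) : ℂ) • T s (J (y k)) =
      ∫ s in Icc (0 : ℝ) 1, ((φ s * b k s : ℝ) : ℂ) • T (τ - s) (J (y k)) := fun k =>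
    T.integral_Ioi_smul_orbit (ψ := fun s => ((φ s * b k s : ℝ) : ℂ))
      (fun s hs => by rw [hφs s hs, zero_mul, Complex.ofReal_zero]) (J (y k)) hτ
  simp_rw [h2]
  rw [h1, ← integral_finsetSum _ fun k _ => hint k,
    ← integral_sub (integrable_finsetSum _ fun k _ => hint k) hcint]
  have h3 : M * Real.exp (|w| * τ) * (‖J‖ * ε) =
      ∫ s in Icc (0 : ℝ) 1, φ s * (M * Real.exp (|w| * τ) * (‖J‖ * ε)) := by
    rw [integral_mul_const, hφI, one_mul]
  rw [h3]
  refine norm_integral_le_of_norm_le (hφint.mul_const _) ?_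
  filter_upwards [ae_restrict_mem measurableSet_Icc] with s hs
  have hτs : 0 ≤ τ - s := sub_nonneg.2 (hs.2.trans hτ.le)
  have h4 : T τ x = T (τ - s) (J (g ⟨s, hs⟩)) := by
    rw [hg, ← ContinuousLinearMap.comp_apply, ← T.map_add _ _ hτs hs.1, sub_add_cancel]
  have h5 : ∑ k, ((φ s * b k s : ℝ) : ℂ) • T (τ - s) (J (y k)) - (φ s : ℂ) • T τ x =
      (φ s : ℂ) • T (τ - s) (J (∑ k, b k s • y k - g ⟨s, hs⟩)) := by
    rw [h4, map_sub, map_sub, smul_sub, map_sum, map_sum, Finset.smul_sum]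
    congr 1
    refine Finset.sum_congr rfl fun k _ => ?_
    rw [← Complex.coe_smul, map_smul, map_smul, smul_smul, Complex.ofReal_mul]
  rw [h5, norm_smul, Complex.norm_real, Real.norm_of_nonneg (hφ0 s)]
  have h6 : ‖T (τ - s)‖ ≤ M * Real.exp (|w| * τ) := by
    refine (hM _ hτs).trans ?_
    refine mul_le_mul_of_nonneg_left (Real.exp_le_exp.2 ?_) hM0
    calc w * (τ - s) ≤ |w| * (τ - s) := by gcongr; exact le_abs_self w
      _ ≤ |w| * τ := by gcongr; linarith [hs.1]
  have h7 : ‖J (∑ k, b k s • y k - g ⟨s, hs⟩)‖ ≤ ‖J‖ * ε :=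
    (J.le_opNorm _).trans (mul_le_mul_of_nonneg_left (happ ⟨s, hs⟩) (norm_nonneg _))
  have h8 := hφ0 s
  calc _ ≤ φ s * (‖T (τ - s)‖ * ‖J (∑ k, b k s • y k - g ⟨s, hs⟩)‖) := by
        gcongr
        exact (T (τ - s)).le_opNorm _
    _ ≤ _ := by gcongr

/-- The function lives on an interval of length one, so its supremum bounds all its `L^p` norms at
once and the constant is independent of `p`. -/
theorem eLpNorm_weighted_le {φ : ℝ → ℝ} (hφ0 : ∀ s, 0 ≤ φ s)
    (hφs : ∀ s, s ∉ Icc (0 : ℝ) 1 → φ s = 0) {F : ℝ} (hF : ∀ s, φ s ≤ F)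
    {g : unitInterval → Y} {G : ℝ} (hG : ∀ s, ‖g s‖ ≤ G)
    {n : ℕ} {b : Fin n → ℝ → ℝ} {y : Fin n → Y} {ε : ℝ}
    (happ : ∀ s : unitInterval, ‖∑ k, b k s • y k - g s‖ ≤ ε) {a : ℝ} (ha : 0 ≤ a) (p : ℝ≥0∞) :
    eLpNorm (fun s : ℝ => ∑ k, (Complex.exp (-(a * s)) * ((φ s * b k s : ℝ) : ℂ)) • y k) p volume ≤
      ENNReal.ofReal (F * (G + ε)) := by
  have hsum : ∀ s : ℝ, ∑ k, (Complex.exp (-(a * s)) * ((φ s * b k s : ℝ) : ℂ)) • y k =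
      (Complex.exp (-(a * s)) * (φ s : ℂ)) • ∑ k, b k s • y k := by
    intro s
    rw [Finset.smul_sum]
    refine Finset.sum_congr rfl fun k _ => ?_
    rw [← Complex.coe_smul, smul_smul, Complex.ofReal_mul, mul_assoc]
  simp_rw [hsum]
  rw [← eLpNorm_restrict_eq_of_support_subset (s := Icc (0 : ℝ) 1)]
  · refine (eLpNorm_le_of_ae_bound (C := F * (G + ε)) ?_).trans (by simp)
    filter_upwards [ae_restrict_mem measurableSet_Icc] with s hs
    have h1 : ‖∑ k, b k s • y k‖ ≤ G + ε := by
      have h2 := norm_add_le (g ⟨s, hs⟩) (∑ k, b k s • y k - g ⟨s, hs⟩)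
      rw [add_sub_cancel] at h2
      exact h2.trans (add_le_add (hG _) (happ ⟨s, hs⟩))
    have h2 : ‖Complex.exp (-(a * s))‖ ≤ 1 := by
      rw [← Complex.ofReal_mul, ← Complex.ofReal_neg, Complex.norm_exp_ofReal,
        Real.exp_le_one_iff]
      nlinarith [hs.1]
    rw [norm_smul, norm_mul, Complex.norm_real, Real.norm_of_nonneg (hφ0 s)]
    have h3 := hφ0 s
    have h4 : 0 ≤ G + ε := (norm_nonneg _).trans h1
    calc _ ≤ 1 * F * (G + ε) :=
          mul_le_mul (mul_le_mul h2 (hF s) h3 zero_le_one) h1 (norm_nonneg _)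
            (by linarith [hF s])
      _ = _ := by ring
  · intro s hs
    by_contra h
    exact hs (by simp only [hφs s h, Complex.ofReal_zero, mul_zero, zero_smul])

/-- Multiplier bounds for the resolvent on `Y` imply growth bounds for the semigroup on `Y`. -/
theorem exists_growth_of_multBound [CompleteSpace Y] [CompleteSpace X] (T : C0Semigroup X)
    {B : X →ₗ.[ℂ] X} (hB : T.IsGenerator B) (hρ : {z : ℂ | 0 < z.re} ⊆ B.resolventSet)
    {w M : ℝ} (hM0 : 0 ≤ M) (hM : ∀ t : ℝ, 0 ≤ t → ‖T t‖ ≤ M * Real.exp (w * t)) (J : Y →L[ℂ] X)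
    {M₁ : ℝ} (hM₁ : 0 ≤ M₁) (horb : ∀ x : Y, ∃ g : C(unitInterval, Y),
      ∀ s : unitInterval, J (g s) = T s (J x) ∧ ‖g s‖ ≤ M₁ * ‖x‖)
    {p q : ℝ≥0∞} (hq : 1 ≤ q) {Ω : ℝ → ℝ} (hΩ : AntitoneOn Ω (Ioi 0)) (hΩ0 : ∀ a, 0 < a → 0 ≤ Ω a)
    (hmod : ∀ a : ℝ, 0 < a →
      IsModerate (fun ξ : ℝ => B.resolvent ((a : ℂ) + Complex.I * ξ) ∘L J))
    (hbd : ∀ a : ℝ, 0 < a →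
      MultBound p q (fun ξ : ℝ => B.resolvent ((a : ℂ) + Complex.I * ξ) ∘L J) (Ω a)) :
    ∃ D : ℝ, 0 ≤ D ∧ ∀ t : ℝ, 2 ≤ t → ‖T t ∘L J‖ ≤ D * Ω t⁻¹ := by
  obtain ⟨φ, hφ, hφc, hφ0, hφs, hφi⟩ := exists_unit_density
  obtain ⟨F, hF⟩ := hφ.continuous.bounded_above_of_compact_support hφc
  have hF' : ∀ s, φ s ≤ F := fun s => (le_abs_self _).trans (hF s)
  have hF0 : 0 ≤ F := (hφ0 0).trans (hF' 0)
  set M₂ := M * Real.exp |w| with hM₂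
  have hM₂0 : 0 ≤ M₂ := by positivity
  -- `M₂` bounds the semigroup on `[0, 1]`, the factor `e` undoes `e^{-τ/t}` for `τ ≤ t`, and `F *
  -- M₁` bounds the input. The assumption `2 ≤ t` ensures `τ > 1` on `(t - 1, t]`.
  refine ⟨M₂ * (Real.exp 1 * (F * M₁)), by positivity, fun t ht => ?_⟩
  have ht0 : 0 < t := by linarith
  have ha : 0 < t⁻¹ := inv_pos.2 ht0
  have hΩt := hΩ0 _ ha
  refine ContinuousLinearMap.opNorm_le_bound _ (by positivity) fun x => ?_
  obtain ⟨g, hg⟩ := horb x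
  set Q := M * Real.exp (|w| * t) * ‖J‖ with hQ
  have key : ∀ ε : ℝ, 0 < ε → ‖T t (J x)‖ ≤
      M₂ * (Real.exp 1 * (Ω t⁻¹ * (F * (M₁ * ‖x‖ + ε))) + Q * ε) := by
    intro ε hε
    obtain ⟨n, b, y, hb, happ⟩ := exists_contDiff_approx g hε
    set ψ : Fin n → ℝ → ℂ := fun k s => ((φ s * b k s : ℝ) : ℂ) with hψ
    have hψs : ∀ k, ContDiff ℝ ∞ (ψ k) := fun k =>
      Complex.ofRealCLM.contDiff.comp (hφ.mul (hb k))
    have hψc : ∀ k, HasCompactSupport (ψ k) := fun k =>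
      (hφc.mul_right (f' := b k)).comp_left (g := Complex.ofReal) Complex.ofReal_zero
    set u : ℝ → X := fun τ => ∑ k, multOp (fun ξ : ℝ =>
      B.resolvent (((t⁻¹ : ℝ) : ℂ) + Complex.I * ξ) ∘L J)
        (tensor (expWeight (hψs k) (hψc k) t⁻¹) (y k)) τ with hu
    have huN : eLpNorm u q volume ≤ ENNReal.ofReal (Ω t⁻¹ * (F * (M₁ * ‖x‖ + ε))) := by
      refine ((hbd _ ha).eLpNorm_sum_tensor_le (isStronglyMeas_resolvent hρ J ha) (hmod _ ha) hΩt
        (fun k => expWeight (hψs k) (hψc k) t⁻¹) y).trans ?_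
      rw [ENNReal.ofReal_mul hΩt]
      gcongr
      exact eLpNorm_weighted_le hφ0 hφs hF' (fun s => (hg s).2) happ ha.le p
    -- The output at `τ` is `e^{-τ/t}` times an approximation of `T τ (J x)`, and `T (t - τ)`
    -- carries that vector to `T t (J x)`.
    have hlow : ∀ τ ∈ Ioc (t - 1) t, ‖T t (J x)‖ ≤ M₂ * (Real.exp 1 * ‖u τ‖ + Q * ε) := by
      intro τ hτ
      have hτ1 : 1 < τ := by linarith [hτ.1]
      have h1 := T.norm_orbit_sub_le hM0 hM J hφ.continuous hφ0 hφs hφi (fun s => (hg s).1)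
        (fun k => (hb k).continuous) happ hτ1
      have h2 : u τ = Complex.exp (-((t⁻¹ : ℝ) * τ)) • ∑ k, ∫ s in Ioi (0 : ℝ),
          ((φ (τ - s) * b k (τ - s) : ℝ) : ℂ) • T s (J (y k)) := by
        rw [hu, Finset.smul_sum]
        exact Finset.sum_congr rfl fun k _ =>
          T.multOp_resolvent_tensor hB hρ hM J hq hΩ hΩ0 hmod hbd (hψs k) (hψc k) (y k) ha τ
      set S := ∑ k, ∫ s in Ioi (0 : ℝ), ((φ (τ - s) * b k (τ - s) : ℝ) : ℂ) • T s (J (y k))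
      have h3 : ‖S‖ ≤ Real.exp 1 * ‖u τ‖ := by
        rw [h2, norm_smul, ← Complex.ofReal_mul, ← Complex.ofReal_neg, Complex.norm_exp_ofReal,
          ← mul_assoc, ← Real.exp_add]
        refine le_mul_of_one_le_left (norm_nonneg _) (Real.one_le_exp ?_)
        have : t⁻¹ * τ ≤ t⁻¹ * t := mul_le_mul_of_nonneg_left hτ.2 ha.le
        rw [inv_mul_cancel₀ ht0.ne'] at this
        linarith
      have h4 : ‖T τ (J x)‖ ≤ Real.exp 1 * ‖u τ‖ + Q * ε := by
        have h5 := norm_sub_norm_le (T τ (J x)) S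
        rw [norm_sub_rev] at h5
        have h6 : M * Real.exp (|w| * τ) * (‖J‖ * ε) ≤ Q * ε := by
          rw [hQ, ← mul_assoc]
          gcongr
          exact hτ.2
        linarith
      have h7 : T t (J x) = T (t - τ) (T τ (J x)) := by
        rw [← ContinuousLinearMap.comp_apply (T (t - τ)),
          ← T.map_add _ _ (sub_nonneg.2 hτ.2) (by linarith), sub_add_cancel]
      have h8 : ‖T (t - τ)‖ ≤ M₂ := by
        refine (hM _ (sub_nonneg.2 hτ.2)).trans ?_
        rw [hM₂]
        gcongr
        calc w * (t - τ) ≤ |w| * (t - τ) :=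
              mul_le_mul_of_nonneg_right (le_abs_self w) (sub_nonneg.2 hτ.2)
          _ ≤ |w| * 1 := by gcongr; linarith [hτ.1]
          _ = |w| := mul_one _
      rw [h7]
      exact ((T (t - τ)).le_opNorm _).trans (by gcongr)
    -- The case `M₂ = 0` is separate, as the lower bound `c` divides by `M₂`; there `hlow` already
    -- gives `T t (J x) = 0`.
    rcases hM₂0.eq_or_lt with h0 | hM₂pos
    · have := hlow t ⟨by linarith, le_rfl⟩
      rw [← h0, zero_mul] at this ⊢
      exact this
    set c := (‖T t (J x)‖ / M₂ - Q * ε) / Real.exp 1 with hc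
    have hcu : ∀ τ ∈ Ioc (t - 1) t, c ≤ ‖u τ‖ := by
      intro τ hτ
      rw [hc, div_le_iff₀ (Real.exp_pos 1), sub_le_iff_le_add, div_le_iff₀ hM₂pos, mul_comm,
        mul_comm ‖u τ‖]
      exact hlow τ hτ
    -- The interval `(t - 1, t]` has measure one, so a constant has the same `L^q` norm on it for
    -- every `q`. The maximum with `0` covers a negative `c`.
    have hcE : ENNReal.ofReal c ≤ eLpNorm u q volume := by
      have hq0 : q ≠ 0 := (one_pos.trans_le hq).ne'
      have hvol : volume.restrict (Ioc (t - 1) t) univ = 1 := by simp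
      have hne : volume.restrict (Ioc (t - 1) t) ≠ 0 := fun h => by simp [h] at hvol
      calc ENNReal.ofReal c = eLpNorm (fun _ : ℝ => max c 0) q (volume.restrict (Ioc (t - 1) t)) := by
            rw [eLpNorm_const _ hq0 hne, hvol, ENNReal.one_rpow, mul_one, ← ofReal_norm,
              Real.norm_of_nonneg (le_max_right c 0), ENNReal.ofReal_max, ENNReal.ofReal_zero,
              max_eq_left zero_le]
        _ ≤ eLpNorm u q (volume.restrict (Ioc (t - 1) t)) := by
            refine eLpNorm_mono_ae ?_
            filter_upwards [ae_restrict_mem measurableSet_Ioc] with τ hτ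
            rw [Real.norm_of_nonneg (le_max_right c 0)]
            exact max_le (hcu τ hτ) (norm_nonneg _)
        _ ≤ _ := eLpNorm_mono_measure _ Measure.restrict_le_self
    have h1 : c ≤ Ω t⁻¹ * (F * (M₁ * ‖x‖ + ε)) :=
      (ENNReal.ofReal_le_ofReal_iff (by positivity)).1 (hcE.trans huN)
    rw [hc, div_le_iff₀ (Real.exp_pos 1), sub_le_iff_le_add, div_le_iff₀ hM₂pos] at h1
    calc _ ≤ _ := h1
      _ = _ := by ring
  -- The factor `Q` grows exponentially in `t`, but it only multiplies `ε` and disappears in the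
  -- limit for fixed `t`.
  have hlim : Tendsto (fun ε : ℝ => M₂ * (Real.exp 1 * (Ω t⁻¹ * (F * (M₁ * ‖x‖ + ε))) + Q * ε))
      (𝓝[>] 0) (𝓝 (M₂ * (Real.exp 1 * (Ω t⁻¹ * (F * (M₁ * ‖x‖ + 0))) + Q * 0))) :=
    (Continuous.tendsto (by fun_prop) 0).mono_left nhdsWithin_le_nhds
  have h := ge_of_tendsto hlim (by filter_upwards [self_mem_nhdsWithin] with ε hε using key ε hε)
  calc ‖T t (J x)‖ ≤ _ := h
    _ = _ := by ring

end C0Semigroup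

/-! ### Orbits in the fractional domain. -/

namespace C0Semigroup

variable {X : Type*} [NormedAddCommGroup X] [NormedSpace ℂ X]

namespace FracDomain

variable [CompleteSpace X] {T : C0Semigroup X} {ω γ : ℝ} {hω : T.growthBound < (ω : EReal)}

theorem commute_negFracPow (T : C0Semigroup X) {ω γ : ℝ} (hω : T.growthBound < (ω : EReal))
    {s : ℝ} (hs : 0 ≤ s) (x : X) :
    T s (T.negFracPow ω γ hω x) = T.negFracPow ω γ hω (T s x) := by
  rcases le_or_gt γ 0 with hγ | hγ
  · rw [T.negFracPow_of_nonpos hω hγ]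
    rfl
  · rw [T.negFracPow_apply hω hγ, T.negFracPow_apply hω hγ, map_smul,
      ← ContinuousLinearMap.integral_comp_comm _ (T.integrableOn_fracIntegrand hω hγ x)]
    congr 1
    refine setIntegral_congr_fun measurableSet_Ioi fun t ht => ?_
    have ht' : (0 : ℝ) ≤ t := le_of_lt ht
    simp only [fracIntegrand]
    rw [map_smul, ← ContinuousLinearMap.comp_apply, ← T.map_add s t hs ht', add_comm,
      T.map_add t s ht' hs, ContinuousLinearMap.comp_apply]

/-- Orbits of elements of a fractional domain are continuous in its graph norm. -/
theorem exists_orbit {w M : ℝ} (hM0 : 0 ≤ M)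
    (hM : ∀ t : ℝ, 0 ≤ t → ‖T t‖ ≤ M * Real.exp (w * t)) (x : T.FracDomain ω γ hω) :
    ∃ g : C(unitInterval, T.FracDomain ω γ hω), ∀ s : unitInterval,
      incl T ω γ hω (g s) = T s (incl T ω γ hω x) ∧ ‖g s‖ ≤ M * Real.exp |w| * ‖x‖ := by
  -- `T s` commutes with the negative power, so it maps the fractional domain into itself and
  -- commutes with `fracPow`. Continuity and bounds in the graph norm are thus those of two orbits
  -- in `X`.
  have h : ∀ s : unitInterval, ∃ z : T.FracDomain ω γ hω,
      inclₗ z = T s (inclₗ x) ∧ fracPow z = T s (fracPow x) := fun s =>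
    exists_of_eq _ _ (by rw [← commute_negFracPow T hω s.2.1, negFracPow_fracPow])
  choose g hg1 hg2 using h
  have hcont : ∀ z : X, Continuous fun s : unitInterval => T s z := fun z =>
    (T.continuousOn_orbit z).comp_continuous continuous_subtype_val fun s => s.2.1
  refine ⟨⟨g, continuous_iff_continuousAt.2 fun s => ?_⟩, fun s => ⟨hg1 s, ?_⟩⟩
  · rw [ContinuousAt, tendsto_iff_norm_sub_tendsto_zero]
    have h1 := tendsto_iff_norm_sub_tendsto_zero.1 ((hcont (inclₗ x)).tendsto s)
    have h2 := tendsto_iff_norm_sub_tendsto_zero.1 ((hcont (fracPow x)).tendsto s)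
    have h3 := h1.add h2
    rw [add_zero] at h3
    refine h3.congr fun r => ?_
    rw [norm_eq, map_sub, map_sub, hg1, hg1, hg2, hg2]
  · have hT : ‖T s‖ ≤ M * Real.exp |w| := by
      refine (hM s s.2.1).trans ?_
      gcongr
      calc w * s ≤ |w| * s := mul_le_mul_of_nonneg_right (le_abs_self w) s.2.1
        _ ≤ |w| * 1 := mul_le_mul_of_nonneg_left s.2.2 (abs_nonneg w)
        _ = |w| := mul_one _
    change ‖g s‖ ≤ _
    rw [norm_eq, norm_eq, hg1, hg2, mul_add]
    exact add_le_add (((T s).le_opNorm _).trans (by gcongr)) (((T s).le_opNorm _).trans (by gcongr))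

end FracDomain

end C0Semigroup

/-! ### The equivalence. -/

theorem corollary3p13 {X : Type*} [NormedAddCommGroup X] [NormedSpace ℂ X] [CompleteSpace X]
    (T : C0Semigroup X) (A : X →ₗ.[ℂ] X) (hA : T.IsGenerator (-A))
    (hρ : {z : ℂ | z.re < 0} ⊆ A.resolventSet)
    (α γ : ℝ) (hα : 0 ≤ α) (hγ : 0 ≤ γ)
    (ω : ℝ) (hω : T.growthBound < (ω : EReal)) :
    (∃ C : ℝ, 0 ≤ C ∧ ∀ t : ℝ, 0 ≤ t →
      ‖T t ∘L C0Semigroup.FracDomain.incl T ω γ hω‖ ≤ C * (t ^ α + 1)) ↔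
    (∃ p q : ℝ≥0∞, 1 ≤ p ∧ 1 ≤ q ∧ ∃ C' : ℝ, 0 ≤ C' ∧ ∀ a : ℝ, 0 < a →
      (fun ξ : ℝ => (-A).resolvent ((a : ℂ) + Complex.I * ξ) ∘L
          C0Semigroup.FracDomain.incl T ω γ hω) ∈ FourierMult.Mult p q ∧
      FourierMult.multNorm p q (fun ξ : ℝ => (-A).resolvent ((a : ℂ) + Complex.I * ξ) ∘L
          C0Semigroup.FracDomain.incl T ω γ hω) ≤ C' * (a ^ (-α) + 1)) := by
  obtain ⟨w, -, M, hM0, hM⟩ := T.exists_bound hω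
  have hρ' : {z : ℂ | 0 < z.re} ⊆ (-A).resolventSet := fun z hz =>
    LinearPMap.neg_mem_resolventSet_neg (hρ (by simpa using hz))
  constructor
  · rintro ⟨C, hC0, hC⟩
    exact ⟨1, ⊤, le_rfl, le_top,
      T.exists_mult_of_growth hA hρ' hM (C0Semigroup.FracDomain.incl T ω γ hω) hα hC0 hC⟩
  · rintro ⟨p, q, -, hq, C', hC', h⟩
    set J := C0Semigroup.FracDomain.incl T ω γ hω
    -- The norm is an infimum; the added `1` gives strict inequality, so that an admissible constant
    -- lies below this value.
    have hanti : AntitoneOn (fun a : ℝ => C' * (a ^ (-α) + 1) + 1) (Ioi 0) := by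
      intro a ha b _ hab
      have := Real.rpow_le_rpow_of_nonpos ha hab (neg_nonpos.2 hα)
      simp only
      gcongr
    obtain ⟨D, hD0, hD⟩ := T.exists_growth_of_multBound hA hρ' hM0 hM J (by positivity)
      (C0Semigroup.FracDomain.exists_orbit hM0 hM) hq hanti
      (fun a ha => by have := Real.rpow_nonneg (le_of_lt ha) (-α); positivity)
      (fun a ha => (h a ha).1.2.1)
      (fun a ha => FourierMult.multBound_of_multNorm_lt (h a ha).1
        ((h a ha).2.trans_lt (lt_add_one _)))
    -- The first summand serves for `t ≥ 2`, where `a = 1/t` turns `a^{-α}` into `t^α`; the second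
    -- is the exponential bound on `[0, 2]`.
    refine ⟨D * (C' + 1) + M * Real.exp (|w| * 2) * ‖J‖, by positivity, fun t ht => ?_⟩
    have htα : 0 ≤ t ^ α := Real.rpow_nonneg ht α
    have hN : 0 ≤ M * Real.exp (|w| * 2) * ‖J‖ := by positivity
    rcases le_total 2 t with h2 | h2
    · have h1 := hD t h2
      rw [Real.inv_rpow ht, Real.rpow_neg ht, inv_inv] at h1
      have h3 : D * (C' * (t ^ α + 1) + 1) ≤ D * ((C' + 1) * (t ^ α + 1)) := by
        gcongr
        linarith
      have h4 := mul_nonneg hN (by linarith : 0 ≤ t ^ α + 1)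
      linarith
    · have h1 : ‖T t ∘L J‖ ≤ M * Real.exp (|w| * 2) * ‖J‖ := by
        refine (ContinuousLinearMap.opNorm_comp_le _ _).trans ?_
        gcongr
        refine (hM t ht).trans (mul_le_mul_of_nonneg_left (Real.exp_le_exp.2 ?_) hM0)
        exact (mul_le_mul_of_nonneg_right (le_abs_self w) ht).trans
          (mul_le_mul_of_nonneg_left h2 (abs_nonneg w))
      have h3 : 0 ≤ D * (C' + 1) * (t ^ α + 1) := by positivity
      have h4 := mul_nonneg hN htα
      linarith
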